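/- There is an absolute constant $K>0$ such that for all constants $\bar\lambda_1>\bar\lambda_2>0$ there are constants $c_0>0$ and, for every $a>0$, constants $C_a,c_a>0$ (depending only on $\bar\lambda_1,\bar\lambda_2$ and, for the latter two, on $a$) with the following property. Let $r,L>0$ with $Lr\ge K$ and let $k,m$ be positive integers. Then there exist a dimension $n$ and an $L$-Lipschitz map (generative model) $G:B_2^k(r)\to\mathcal S^{n-1}\subset\mathbb R^n$, where $B_2^k(r)=\{z\in\mathbb R^k:\|z\|_2\le r\}$ and $\mathcal S^{n-1}$ is the Euclidean unit sphere, such that the following holds. For $\bar{x}\in\mathrm{Range}(G)$ put $\bar V=(\bar\lambda_1-\bar\lambda_2)\bar x\bar x^T+\bar\lambda_2 I_n$, let $x_1,\dots,x_m$ be independent samples from $\mathcal N(0,\bar V)$, and let $P_V^{(\bar x,m)}$ be the distribution on $\mathbb R^{n\times n}$ of the non-centered sample covariance matrix $V=\frac1m\sum_{i=1}^m x_ix_i^T$. 1. (Lower bound.) Every (measurable) estimator $\hat v=\hat v(V)\in\mathbb R^n$ satisfies $$\sup_{\bar x\in\mathrm{Range}(G)}\mathbb E_{V\sim P_V^{(\bar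 x,m)}}\big[\|\hat v\hat v^T-\bar x\bar x^T\|_{\mathrm F}\big]\ \ge\ c_0\,\min\Big\{1,\sqrt{\tfrac{k\log(Lr)}{m}}\Big\}.$$ In particular the left-hand side is $\Omega\big(\sqrt{k\log(Lr)/m}\big)$ whenever $m=\Omega(k\log(Lr))$. 2. (Population matrix.) For every $\bar x\in\mathrm{Range}(G)$, $\mathbb E[V]=\bar V$, and $\bar V$ is positive semidefinite with eigenvalues $(\bar\lambda_1,\bar\lambda_2,\dots,\bar\lambda_2)$, where $\bar\lambda_1>\bar\lambda_2>0$, and with unit leading eigenvector $\bar x$. 3. (Perturbation.) For every $\bar x\in\mathrm{Range}(G)$, every $a>0$ and all finite sets $S_1,S_2\subset\mathbb R^n$ with $m\ge a\log(|S_1|\cdot|S_2|)$, with probability at least $1-e^{-c_a\log(|S_1|\cdot|S_2|)}-e^{-c_a n}$ the matrix $E=V-\bar V$ satisfies $$|s_1^TEs_2|\le C_a\sqrt{\tfrac{\log(|S_1|\cdot|S_2|)}{m}}\,\|s_1\|_2\|s_2\|_2\quad\text{for all }s_1\in S_1,\ s_2\in S_2,\qquad\text{and}\qquad\|E\|_{2\to2}\le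 C_a\,\tfrac nm .$$ -/

import Mathlib

open MeasureTheory ProbabilityTheory

noncomputable section

/-- Real matrices carry the product (equivalently, Borel) sigma-algebra of their entries. -/
instance matrixMeasurableSpace {n : ℕ} : MeasurableSpace (Matrix (Fin n) (Fin n) ℝ) :=
  inferInstanceAs (MeasurableSpace (Fin n → Fin n → ℝ))

/-- The Frobenius norm of a real square matrix. -/
def frobNorm {n : ℕ} (A : Matrix (Fin n) (Fin n) ℝ) : ℝ :=
  √(∑ i, ∑ j, A i j ^ 2)

/-- The rank-one matrix `x xᵀ`. -/
def outerSelf {n : ℕ} (x : EuclideanSpace ℝ (Fin n)) : Matrix (Fin n) (Fin n) ℝ :=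
  Matrix.vecMulVec x.ofLp x.ofLp

/-- The spiked population covariance `(l₁ - l₂) x xᵀ + l₂ I`. -/
def spikedCov {n : ℕ} (l₁ l₂ : ℝ) (x : EuclideanSpace ℝ (Fin n)) :
    Matrix (Fin n) (Fin n) ℝ :=
  (l₁ - l₂) • outerSelf x + l₂ • (1 : Matrix (Fin n) (Fin n) ℝ)

/-- The non-centered sample covariance `(1/m) ∑ᵢ xᵢ xᵢᵀ` of the samples `x₁, …, x_m`. -/
def sampleCov {n m : ℕ} (xs : Fin m → EuclideanSpace ℝ (Fin n)) : Matrix (Fin n) (Fin n) ℝ :=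
  (m : ℝ)⁻¹ • ∑ i, outerSelf (xs i)

/-- The law on `n × n` matrices of the non-centered sample covariance of `m` independent samples
from the centered Gaussian distribution with covariance `spikedCov l₁ l₂ x`. -/
def spikedSampleCovLaw {n : ℕ} (l₁ l₂ : ℝ) (m : ℕ) (x : EuclideanSpace ℝ (Fin n)) :
    Measure (Matrix (Fin n) (Fin n) ℝ) :=
  (Measure.pi fun _ : Fin m => multivariateGaussian 0 (spikedCov l₁ l₂ x)).map sampleCov

/-- `A` is positive semidefinite, its eigenvalues with multiplicity, in non-increasing order, are
`lam 0 > lam 1 ≥ lam 2 ≥ … ≥ 0`, and `x` is a unit eigenvector for the largest one. -/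
structure HasLeadingEigenpair {n : ℕ} (A : Matrix (Fin n) (Fin n) ℝ) (lam : Fin n → ℝ)
    (x : EuclideanSpace ℝ (Fin n)) : Prop where
  posSemidef : A.PosSemidef
  charpoly_eq : A.charpoly = ∏ i, (Polynomial.X - Polynomial.C (lam i))
  antitone : Antitone lam
  nonneg : ∀ i, 0 ≤ lam i
  gap : ∀ i j : Fin n, (i : ℕ) = 0 → (j : ℕ) ≠ 0 → lam j < lam i
  norm_eq_one : ‖x‖ = 1
  eigenvector : ∀ i : Fin n, (i : ℕ) = 0 → A.mulVec x.ofLp = lam i • x.ofLp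

/-- The perturbation `E` is small, with constant `C` and `m` samples: as a bilinear form on the
finite sets `S₁` and `S₂`, and in spectral norm. -/
structure SmallPerturbation {n : ℕ} (C : ℝ) (m : ℕ) (S₁ S₂ : Finset (EuclideanSpace ℝ (Fin n)))
    (E : Matrix (Fin n) (Fin n) ℝ) : Prop where
  bilinear : ∀ s₁ ∈ S₁, ∀ s₂ ∈ S₂, |s₁.ofLp ⬝ᵥ E.mulVec s₂.ofLp| ≤
    C * √(Real.log ((S₁.card : ℝ) * (S₂.card : ℝ)) / (m : ℝ)) * ‖s₁‖ * ‖s₂‖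
  spectral : ‖Matrix.toEuclideanCLM (𝕜 := ℝ) E‖ ≤ C * ((n : ℝ) / (m : ℝ))

end

/-! The dimension is free, and this freedom serves both halves of the theorem.

Lower bound. A maximal `2/L`-separated set in the ball of radius `r` has at least `(Lr/2)^k` points.
Over each point put a tent of radius `1/L`, and let `G` lean from a fixed pole by an amount `δ`
towards a private orthonormal direction under each tent. The tents have disjoint supports, so `G` is
`L`-Lipschitz when `δ ≤ 1/2`, and it sends the centers to spikes whose projectors are pairwise
`δ`-separated in Frobenius norm. A sample with spike `x` is `√l₂ z + √(l₁-l₂) g x`. As all spikes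
share their polar component, their sample laws are images, under one common map, of shears `(g, z) ↦
(g, z + g h)` of a standard Gaussian. By Cameron-Martin the likelihood ratio of `m` shears has
second moment at most `exp(2mκδ²)`, where `κ = (l₁-l₂)/l₂`. With `δ` proportional to `min(1, √(k
log(Lr)/m))` this is at most one sixteenth of the number of spikes, so no estimator identifies the
spike with probability above 1/2 on average (`sum_withDensity_le`), and Markov's inequality yields
the risk bound.

Perturbation. The bilinear bound is polarization, a Chernoff bound for centered Gaussian squares,
and a union bound over the pairs in `S₁ × S₂`. For the spectral bound `n` is taken at least `12 m²
e^m`: then the samples are nearly orthogonal with squared norms at most `4 l₁ n`, so the sample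
covariance has norm of order `n/m`. The failure probability is at most `e^{-m}/4`, which `m ≥ a log
N`, with `N = |S₁||S₂|`, converts into a power of `N`. -/

open scoped RealInnerProductSpace

/-! ### Exponential moments of Gaussian squares -/

/-- The exponential moments of the square of a standard Gaussian variable. -/
lemma lintegral_exp_mul_sq_gaussianReal {s : ℝ} (hs : 2 * s < 1) :
    ∫⁻ x, ENNReal.ofReal (Real.exp (s * x ^ 2)) ∂gaussianReal 0 1
      = ENNReal.ofReal (1 / √(1 - 2 * s)) := by
  have hb : 0 < 1 / 2 - s := by linarith
  rw [gaussianReal_of_var_ne_zero 0 one_ne_zero,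
    lintegral_withDensity_eq_lintegral_mul _ (measurable_gaussianPDF 0 1) (by fun_prop)]
  have h1 : ∀ x : ℝ, (gaussianPDF 0 1 * fun x => ENNReal.ofReal (Real.exp (s * x ^ 2))) x
      = ENNReal.ofReal ((√(2 * Real.pi))⁻¹ * Real.exp (-(1 / 2 - s) * x ^ 2)) := by
    intro x
    rw [Pi.mul_apply, gaussianPDF, ← ENNReal.ofReal_mul (gaussianPDFReal_nonneg 0 1 x),
      gaussianPDFReal]
    congr 1
    rw [mul_assoc, ← Real.exp_add]
    congr 2
    · simp
    · simp only [NNReal.coe_one]; ring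
  simp_rw [h1]
  rw [← ofReal_integral_eq_lintegral_ofReal ((integrable_exp_neg_mul_sq hb).const_mul _)
    (Filter.Eventually.of_forall fun x => by positivity), integral_const_mul, integral_gaussian]
  congr 1
  have h2 : Real.pi / (1 / 2 - s) = 2 * Real.pi / (1 - 2 * s) := by
    have : 1 - 2 * s ≠ 0 := by linarith
    field_simp
  rw [h2, Real.sqrt_div (by positivity)]
  have : √(2 * Real.pi) ≠ 0 := by positivity
  field_simp

/-- The logarithmic series of `log(1 - 2s)`, cut after its first term, has error at most `8s²` on
this range; the square root halves it. -/
lemma one_div_sqrt_one_sub_le_exp {s : ℝ} (hs : |s| ≤ 1 / 4) :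
    1 / √(1 - 2 * s) ≤ Real.exp (s + 4 * s ^ 2) := by
  have hs' := abs_le.1 hs
  have hpos : 0 < 1 - 2 * s := by linarith
  have h := Real.abs_log_sub_add_sum_range_le (x := 2 * s) (by rw [abs_mul]; norm_num; linarith) 1
  simp only [Finset.sum_range_one] at h
  have h2 : |2 * s| ^ (1 + 1) / (1 - |2 * s|) ≤ 8 * s ^ 2 := by
    rw [abs_mul, abs_two, div_le_iff₀ (by linarith)]
    have h1 := mul_nonneg (sq_nonneg |s|) (by linarith : (0 : ℝ) ≤ 1 - 4 * |s|)
    have h2 : (2 * |s|) ^ (1 + 1) = 4 * |s| ^ 2 := by ring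
    rw [← sq_abs s, h2]
    linarith
  have h3 := (abs_le.1 (h.trans h2)).1
  norm_num at h3
  rw [one_div, ← Real.sqrt_inv, Real.sqrt_le_left (Real.exp_pos _).le, ← Real.exp_nat_mul,
    ← Real.exp_log (inv_pos.2 hpos), Real.log_inv]
  apply Real.exp_le_exp.2
  push_cast
  linarith

/-- Centering cancels the linear term of the exponent, so only a quadratic term in `t` remains. Both
signs of `t` are allowed because both tails are needed. -/
lemma lintegral_exp_sq_sub_gaussianReal_le (v : NNReal) {t : ℝ} (ht : |t| * v ≤ 1 / 4) :
    ∫⁻ x, ENNReal.ofReal (Real.exp (t * (x ^ 2 - v))) ∂gaussianReal 0 v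
      ≤ ENNReal.ofReal (Real.exp (4 * t ^ 2 * v ^ 2)) := by
  have hmap : gaussianReal 0 v = (gaussianReal 0 1).map (fun x => √v * x) := by
    rw [gaussianReal_map_const_mul]
    congr 1
    · simp
    · ext; simp
  have habs : |t * v| ≤ 1 / 4 := by rwa [abs_mul, abs_of_nonneg v.coe_nonneg]
  rw [hmap, lintegral_map (by fun_prop) (by fun_prop)]
  have h1 : ∀ x : ℝ, ENNReal.ofReal (Real.exp (t * ((√v * x) ^ 2 - v)))
      = ENNReal.ofReal (Real.exp (-(t * v))) * ENNReal.ofReal (Real.exp ((t * v) * x ^ 2)) := by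
    intro x
    rw [← ENNReal.ofReal_mul (Real.exp_pos _).le, ← Real.exp_add, mul_pow,
      Real.sq_sqrt v.coe_nonneg]
    congr 2
    ring
  simp_rw [h1]
  rw [lintegral_const_mul _ (by fun_prop), lintegral_exp_mul_sq_gaussianReal
    (by have := (abs_le.1 habs).2; linarith), ← ENNReal.ofReal_mul (Real.exp_pos _).le]
  apply ENNReal.ofReal_le_ofReal
  calc _ ≤ Real.exp (-(t * v)) * Real.exp (t * v + 4 * (t * v) ^ 2) := by
        gcongr; exact one_div_sqrt_one_sub_le_exp habs
    _ = _ := by rw [← Real.exp_add]; congr 1; ring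

/-! ### Product measures: integrals, densities and the Chernoff bound -/

section Pi

variable {ι : Type*} [Fintype ι] {X : ι → Type*} [∀ i, MeasurableSpace (X i)]

lemma lintegral_pi_prod (μ : ∀ i, Measure (X i)) [∀ i, IsProbabilityMeasure (μ i)]
    {f : ∀ i, X i → ENNReal} (hf : ∀ i, Measurable (f i)) :
    ∫⁻ x, ∏ i, f i (x i) ∂Measure.pi μ = ∏ i, ∫⁻ x, f i x ∂μ i := by
  have h := lintegral_prod_eq_prod_lintegral_of_indepFun Finset.univ
    (fun i (x : ∀ i, X i) => f i (x i))
    (iIndepFun_pi (μ := μ) fun i => (hf i).aemeasurable)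
    (fun i => (hf i).comp (measurable_pi_apply i))
  rw [h]
  refine Finset.prod_congr rfl fun i _ => ?_
  exact (measurePreserving_eval μ i).lintegral_comp (hf i)

lemma pi_withDensity_prod (μ : ∀ i, Measure (X i)) [∀ i, IsProbabilityMeasure (μ i)]
    {f : ∀ i, X i → ENNReal} (hf : ∀ i, Measurable (f i))
    [∀ i, SigmaFinite ((μ i).withDensity (f i))] :
    (Measure.pi μ).withDensity (fun x => ∏ i, f i (x i))
      = Measure.pi fun i => (μ i).withDensity (f i) := by
  refine (Measure.pi_eq fun s hs => ?_).symm
  rw [withDensity_apply _ (MeasurableSet.univ_pi hs), ← lintegral_indicator (.univ_pi hs)]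
  have h1 : ∀ x : ∀ i, X i, (Set.univ.pi s).indicator (fun x => ∏ i, f i (x i)) x
      = ∏ i, (s i).indicator (f i) (x i) := by
    intro x
    by_cases hx : x ∈ Set.univ.pi s
    · rw [Set.indicator_of_mem hx]
      exact Finset.prod_congr rfl fun i _ => (Set.indicator_of_mem (hx i trivial) _).symm
    · rw [Set.indicator_of_notMem hx]
      simp only [Set.mem_pi, Set.mem_univ, true_implies, not_forall] at hx
      obtain ⟨i, hi⟩ := hx
      exact (Finset.prod_eq_zero (Finset.mem_univ i) (Set.indicator_of_notMem hi _)).symm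
  simp_rw [h1]
  rw [lintegral_pi_prod μ fun i => (hf i).indicator (hs i)]
  refine Finset.prod_congr rfl fun i _ => ?_
  rw [lintegral_indicator (hs i), withDensity_apply _ (hs i)]

end Pi

/-- The exponential Markov inequality for a sum of independent identically distributed terms. -/
lemma pi_sum_ge_le_exp {X : Type*} [MeasurableSpace X] (μ : Measure X) [IsProbabilityMeasure μ]
    {f : X → ℝ} (hf : Measurable f) {b : ℝ}
    (hb : ∫⁻ x, ENNReal.ofReal (Real.exp (f x)) ∂μ ≤ ENNReal.ofReal (Real.exp b)) (m : ℕ) (t : ℝ) :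
    (Measure.pi fun _ : Fin m => μ) {x | t ≤ ∑ i, f (x i)}
      ≤ ENNReal.ofReal (Real.exp (m * b - t)) := by
  have hexp : ∀ x : Fin m → X, ENNReal.ofReal (Real.exp (∑ i, f (x i)))
      = ∏ i, ENNReal.ofReal (Real.exp (f (x i))) := fun x => by
    rw [Real.exp_sum, ENNReal.ofReal_prod_of_nonneg fun i _ => (Real.exp_pos _).le]
  have hm := mul_meas_ge_le_lintegral₀ (μ := Measure.pi fun _ : Fin m => μ)
    (f := fun x => ENNReal.ofReal (Real.exp (∑ i, f (x i))))
    (Measurable.aemeasurable (Real.measurable_exp.comp (Finset.measurable_sum _ fun i _ =>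
      hf.comp (measurable_pi_apply i))).ennreal_ofReal)
    (ENNReal.ofReal (Real.exp t))
  simp_rw [hexp] at hm
  rw [lintegral_pi_prod (fun _ : Fin m => μ)
    (f := fun _ x => ENNReal.ofReal (Real.exp (f x))) (fun _ => by fun_prop)] at hm
  simp_rw [← hexp] at hm
  have hset : {x : Fin m → X | t ≤ ∑ i, f (x i)}
      = {x | ENNReal.ofReal (Real.exp t) ≤ ENNReal.ofReal (Real.exp (∑ i, f (x i)))} := by
    ext x
    simp [ENNReal.ofReal_le_ofReal_iff (Real.exp_pos _).le]
  rw [hset]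
  have hprod : ∏ _i : Fin m, ∫⁻ x, ENNReal.ofReal (Real.exp (f x)) ∂μ
      ≤ ENNReal.ofReal (Real.exp (m * b)) := by
    calc _ ≤ ∏ _i : Fin m, ENNReal.ofReal (Real.exp b) := Finset.prod_le_prod' fun i _ => hb
      _ = _ := by
        rw [Finset.prod_const, Finset.card_univ, Fintype.card_fin,
          ← ENNReal.ofReal_pow (Real.exp_pos _).le, ← Real.exp_nat_mul]
  rw [sub_eq_add_neg, Real.exp_add, mul_comm, Real.exp_neg, ENNReal.ofReal_mul (by positivity),
    ENNReal.ofReal_inv_of_pos (Real.exp_pos _), mul_comm, ← div_eq_mul_inv,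
    ENNReal.le_div_iff_mul_le (by simp [Real.exp_pos]) (by simp), mul_comm]
  exact hm.trans hprod

/-! ### Cameron-Martin densities and Gaussian shears -/

lemma gaussianReal_map_add_eq_withDensity (h : ℝ) :
    (gaussianReal 0 1).map (fun x => x + h)
      = (gaussianReal 0 1).withDensity
          (fun x => ENNReal.ofReal (Real.exp (h * x - h ^ 2 / 2))) := by
  rw [gaussianReal_map_add_const, gaussianReal_of_var_ne_zero _ one_ne_zero,
    gaussianReal_of_var_ne_zero _ one_ne_zero,
    ← withDensity_mul _ (measurable_gaussianPDF 0 1) (by fun_prop)]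
  congr 1
  ext x
  rw [Pi.mul_apply, gaussianPDF, gaussianPDF, ← ENNReal.ofReal_mul (gaussianPDFReal_nonneg 0 1 x),
    gaussianPDFReal, gaussianPDFReal, mul_assoc (_)⁻¹, ← Real.exp_add]
  congr 3
  simp only [NNReal.coe_one]
  ring

/-- Cameron-Martin formula for the standard Gaussian measure on a finite product. -/
lemma pi_gaussianReal_map_add_eq_withDensity {ι : Type*} [Fintype ι] (h : ι → ℝ) :
    (Measure.pi fun _ : ι => gaussianReal 0 1).map (fun x => x + h)
      = (Measure.pi fun _ : ι => gaussianReal 0 1).withDensity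
          (fun x => ∏ i, ENNReal.ofReal (Real.exp (h i * x i - h i ^ 2 / 2))) := by
  have hp : ∀ i, IsProbabilityMeasure ((gaussianReal 0 1).withDensity
      (fun x => ENNReal.ofReal (Real.exp (h i * x - h i ^ 2 / 2)))) := fun i => by
    rw [← gaussianReal_map_add_eq_withDensity]
    infer_instance
  rw [pi_withDensity_prod (fun _ : ι => gaussianReal 0 1)
    (f := fun i x => ENNReal.ofReal (Real.exp (h i * x - h i ^ 2 / 2))) (fun i => by fun_prop)]
  simp_rw [← gaussianReal_map_add_eq_withDensity]
  rw [← Measure.pi_map_pi (fun i => by fun_prop)]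
  rfl

/-- The likelihood ratio of the shear `(g, z) ↦ (g, z + g h)` under the standard Gaussian
measure. -/
noncomputable def shearDensity {ι : Type*} [Fintype ι] (h : ι → ℝ) (p : ℝ × (ι → ℝ)) : ENNReal :=
  ∏ i, ENNReal.ofReal (Real.exp (p.1 * h i * p.2 i - (p.1 * h i) ^ 2 / 2))

/-- The standard Gaussian measure on `ℝ × ℝ^ι`. -/
noncomputable def gaussianProd (ι : Type*) [Fintype ι] : Measure (ℝ × (ι → ℝ)) :=
  (gaussianReal 0 1).prod (Measure.pi fun _ : ι => gaussianReal 0 1)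

instance {ι : Type*} [Fintype ι] : IsProbabilityMeasure (gaussianProd ι) := by
  unfold gaussianProd; infer_instance

section Shear

variable {ι : Type*} [Fintype ι]

lemma measurable_shearDensity (h : ι → ℝ) : Measurable (shearDensity h) := by
  unfold shearDensity; fun_prop

/-- The shear fixes `g`, so on the fibre over `g` it is a translation by `g h`: Cameron-Martin on
each fibre, then Fubini. -/
lemma gaussianProd_map_shear (h : ι → ℝ) :
    (gaussianProd ι).map (fun p => (p.1, p.2 + p.1 • h))
      = (gaussianProd ι).withDensity (shearDensity h) := by
  have hS : Measurable fun p : ℝ × (ι → ℝ) => (p.1, p.2 + p.1 • h) := by fun_prop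
  ext A hA
  rw [Measure.map_apply hS hA, withDensity_apply _ hA, ← lintegral_indicator hA]
  unfold gaussianProd
  rw [Measure.prod_apply (hS hA),
    lintegral_prod _ ((measurable_shearDensity h).indicator hA).aemeasurable]
  refine lintegral_congr fun g => ?_
  have h1 := pi_gaussianReal_map_add_eq_withDensity (g • h)
  have hA' : MeasurableSet (Prod.mk g ⁻¹' A) := measurable_prodMk_left hA
  have h2 := congrArg (fun ν => ν (Prod.mk g ⁻¹' A)) h1
  simp only at h2
  rw [Measure.map_apply (by fun_prop) hA', withDensity_apply _ hA', ← lintegral_indicator hA'] at h2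
  refine h2.trans (lintegral_congr fun z => ?_)
  rfl

/-- For fixed `g`, the squared density of the shift `g h` is `exp(g²|h|²)` times the density of the
shift `2 g h`, which has mass one. The remaining integral over `g` is an exponential moment of a
Gaussian square. -/
lemma lintegral_shearDensity_sq_le (h : ι → ℝ) (hh : ∑ i, h i ^ 2 ≤ 1 / 4) :
    ∫⁻ p, shearDensity h p ^ 2 ∂gaussianProd ι
      ≤ ENNReal.ofReal (Real.exp (2 * ∑ i, h i ^ 2)) := by
  have h0 : 0 ≤ ∑ i, h i ^ 2 := Finset.sum_nonneg fun i _ => sq_nonneg _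
  unfold gaussianProd
  rw [lintegral_prod _ ((measurable_shearDensity h).pow_const 2).aemeasurable]
  have h1 : ∀ g : ℝ, ∫⁻ z, shearDensity h (g, z) ^ 2 ∂(Measure.pi fun _ : ι => gaussianReal 0 1)
      = ENNReal.ofReal (Real.exp ((∑ i, h i ^ 2) * g ^ 2)) := by
    intro g
    unfold shearDensity
    simp_rw [← Finset.prod_pow]
    rw [lintegral_pi_prod (fun _ : ι => gaussianReal 0 1)
      (f := fun i x => ENNReal.ofReal (Real.exp (g * h i * x - (g * h i) ^ 2 / 2)) ^ 2)
      (fun i => by fun_prop), Finset.sum_mul, Real.exp_sum,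
      ENNReal.ofReal_prod_of_nonneg fun i _ => (Real.exp_pos _).le]
    refine Finset.prod_congr rfl fun i _ => ?_
    have h2 : ∀ x : ℝ, ENNReal.ofReal (Real.exp (g * h i * x - (g * h i) ^ 2 / 2)) ^ 2
        = ENNReal.ofReal (Real.exp (h i ^ 2 * g ^ 2))
          * ENNReal.ofReal (Real.exp (2 * (g * h i) * x - (2 * (g * h i)) ^ 2 / 2)) := by
      intro x
      rw [← ENNReal.ofReal_pow (Real.exp_pos _).le, ← ENNReal.ofReal_mul (Real.exp_pos _).le,
        ← Real.exp_add, ← Real.exp_nat_mul]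
      congr 2
      push_cast
      ring
    simp_rw [h2]
    rw [lintegral_const_mul _ (by fun_prop)]
    have h3 := congrArg (fun ν => ν Set.univ) (gaussianReal_map_add_eq_withDensity (2 * (g * h i)))
    rw [Measure.map_apply (by fun_prop) .univ, withDensity_apply _ .univ] at h3
    simp only [Set.preimage_univ, measure_univ, Measure.restrict_univ] at h3
    rw [← h3, mul_one]
  simp_rw [h1]
  rw [lintegral_exp_mul_sq_gaussianReal (by linarith)]
  apply ENNReal.ofReal_le_ofReal
  refine (one_div_sqrt_one_sub_le_exp (by rwa [abs_of_nonneg h0])).trans (Real.exp_le_exp.2 ?_)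
  nlinarith

end Shear

/-! ### Testing many hypotheses -/

/-- Testing many hypotheses with bounded `χ²`-divergence from a common reference measure: the
average probability of identifying the true one is small. -/
lemma sum_withDensity_le {Ω J : Type*} [MeasurableSpace Ω] [Fintype J] (Q : Measure Ω)
    [IsProbabilityMeasure Q] {f : J → Ω → ENNReal} (hf : ∀ j, Measurable (f j)) {B : ENNReal}
    (hB : ∀ j, ∫⁻ x, f j x ^ 2 ∂Q ≤ B) {A : J → Set Ω} (hA : ∀ j, MeasurableSet (A j))
    (hdisj : Pairwise (Function.onFun Disjoint A)) {t : ENNReal} (ht : t ≠ 0) (ht' : t ≠ ⊤) :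
    ∑ j, Q.withDensity (f j) (A j) ≤ t + Fintype.card J * (B / t) := by
  -- Truncation at level `t`: where the density exceeds `t`, it is dominated by its square over `t`.
  -- The level-`t` parts add up to at most `t` because the sets are disjoint.
  have hpt : ∀ y : ENNReal, y ≤ t + y ^ 2 / t := by
    intro y
    rcases le_total y t with hy | hy
    · exact hy.trans le_self_add
    · refine le_trans ?_ le_add_self
      rw [ENNReal.le_div_iff_mul_le (.inl ht) (.inl ht'), sq]
      gcongr
  have h1 : ∀ j, Q.withDensity (f j) (A j) ≤ t * Q (A j) + B / t := by
    intro j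
    rw [withDensity_apply _ (hA j)]
    calc ∫⁻ x in A j, f j x ∂Q ≤ ∫⁻ x in A j, (t + f j x ^ 2 / t) ∂Q :=
          lintegral_mono fun x => hpt _
      _ = t * Q (A j) + ∫⁻ x in A j, f j x ^ 2 / t ∂Q := by
          rw [lintegral_add_left measurable_const, setLIntegral_const]
      _ ≤ t * Q (A j) + ∫⁻ x, f j x ^ 2 / t ∂Q := by
          gcongr; exact Measure.restrict_le_self
      _ ≤ _ := by
          simp_rw [div_eq_mul_inv]
          rw [lintegral_mul_const _ ((hf j).pow_const 2)]
          gcongr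
          exact hB j
  calc _ ≤ ∑ j, (t * Q (A j) + B / t) := Finset.sum_le_sum fun j _ => h1 j
    _ = t * ∑ j, Q (A j) + Fintype.card J * (B / t) := by
        rw [Finset.sum_add_distrib, ← Finset.mul_sum]; simp
    _ ≤ _ := by
        gcongr
        rw [← tsum_fintype (L := .unconditional J), ← measure_iUnion hdisj hA]
        exact mul_le_of_le_one_right' prob_le_one

/-! ### The spiked covariance: spectrum, Gaussian representation, moments -/

section Spiked

variable {n : ℕ} {l₁ l₂ : ℝ} {x : EuclideanSpace ℝ (Fin n)}

lemma real_inner_eq_dotProduct (u v : EuclideanSpace ℝ (Fin n)) : ⟪u, v⟫ = u.ofLp ⬝ᵥ v.ofLp := by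
  rw [EuclideanSpace.inner_eq_star_dotProduct, dotProduct_comm, star_trivial]

lemma outerSelf_mulVec (x v : EuclideanSpace ℝ (Fin n)) :
    (outerSelf x).mulVec v.ofLp = ⟪x, v⟫ • x.ofLp := by
  rw [outerSelf, Matrix.vecMulVec_mulVec, real_inner_eq_dotProduct]
  ext i; simp [mul_comm]

lemma spikedCov_mulVec (v : EuclideanSpace ℝ (Fin n)) :
    (spikedCov l₁ l₂ x).mulVec v.ofLp = ((l₁ - l₂) * ⟪x, v⟫) • x.ofLp + l₂ • v.ofLp := by
  rw [spikedCov, Matrix.add_mulVec, Matrix.smul_mulVec, Matrix.smul_mulVec, outerSelf_mulVec,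
    Matrix.one_mulVec, smul_smul]

lemma dotProduct_spikedCov_mulVec (u v : EuclideanSpace ℝ (Fin n)) :
    u.ofLp ⬝ᵥ (spikedCov l₁ l₂ x).mulVec v.ofLp = (l₁ - l₂) * ⟪x, u⟫ * ⟪x, v⟫ + l₂ * ⟪u, v⟫ := by
  rw [spikedCov_mulVec, dotProduct_add, dotProduct_smul, dotProduct_smul,
    ← real_inner_eq_dotProduct, ← real_inner_eq_dotProduct, real_inner_comm x u, smul_eq_mul,
    smul_eq_mul]
  ring

lemma isHermitian_spikedCov : (spikedCov l₁ l₂ x).IsHermitian := by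
  ext i j
  simp [spikedCov, outerSelf, Matrix.vecMulVec_apply, Matrix.one_apply, mul_comm, eq_comm]

lemma posSemidef_spikedCov (h₂ : 0 ≤ l₂) (h : l₂ ≤ l₁) : (spikedCov l₁ l₂ x).PosSemidef := by
  refine Matrix.PosSemidef.of_dotProduct_mulVec_nonneg isHermitian_spikedCov fun v => ?_
  have h1 := dotProduct_spikedCov_mulVec (l₁ := l₁) (l₂ := l₂) (x := x) (WithLp.toLp 2 v)
    (WithLp.toLp 2 v)
  rw [star_trivial]
  refine h1.ge.trans' ?_
  rw [mul_assoc, real_inner_self_eq_norm_sq]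
  have : 0 ≤ l₁ - l₂ := by linarith
  have := mul_self_nonneg ⟪x, WithLp.toLp 2 v⟫
  positivity

lemma dotProduct_spikedCov_self_le (h : l₂ ≤ l₁) (hx : ‖x‖ = 1) (v : EuclideanSpace ℝ (Fin n)) :
    v.ofLp ⬝ᵥ (spikedCov l₁ l₂ x).mulVec v.ofLp ≤ l₁ * ‖v‖ ^ 2 := by
  rw [dotProduct_spikedCov_mulVec, real_inner_self_eq_norm_sq]
  have h1 : ⟪x, v⟫ * ⟪x, v⟫ ≤ ‖v‖ ^ 2 := by
    have := real_inner_mul_inner_self_le x v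
    rw [real_inner_self_eq_norm_sq, real_inner_self_eq_norm_sq, hx] at this
    linarith
  nlinarith [mul_le_mul_of_nonneg_left h1 (sub_nonneg.2 h)]

lemma charpoly_spikedCov (hx : ‖x‖ = 1) (hn : 0 < n) :
    (spikedCov l₁ l₂ x).charpoly
      = ∏ i : Fin n, (Polynomial.X - Polynomial.C (if (i : ℕ) = 0 then l₁ else l₂)) := by
  obtain ⟨n, rfl⟩ : ∃ k, n = k + 1 := ⟨n - 1, by omega⟩
  -- A rank-one matrix shifted by a scalar: its characteristic polynomial is a known one evaluated
  -- at a translated variable.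
  have h1 : spikedCov l₁ l₂ x
      = Matrix.vecMulVec ((l₁ - l₂) • x.ofLp) x.ofLp - Matrix.scalar (Fin (n + 1)) (-l₂) := by
    ext i j
    simp [spikedCov, outerSelf, Matrix.vecMulVec_apply, Matrix.one_apply, Matrix.diagonal_apply]
    split_ifs <;> ring
  rw [h1, Matrix.charpoly_sub_scalar, Matrix.charpoly_vecMulVec, smul_dotProduct,
    ← real_inner_eq_dotProduct, real_inner_self_eq_norm_sq, hx, Fin.prod_univ_succ]
  simp [Polynomial.smul_eq_C_mul]
  ring

lemma hasLeadingEigenpair_spikedCov (h₂ : 0 < l₂) (h : l₂ < l₁) (hx : ‖x‖ = 1) (hn : 0 < n) :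
    HasLeadingEigenpair (spikedCov l₁ l₂ x) (fun i => if (i : ℕ) = 0 then l₁ else l₂) x where
  posSemidef := posSemidef_spikedCov h₂.le h.le
  charpoly_eq := charpoly_spikedCov hx hn
  antitone := by
    intro i j hij
    have hij' : (i : ℕ) ≤ j := hij
    simp only
    split_ifs with h1 h2 h2
    · exact le_rfl
    · omega
    · exact h.le
    · exact le_rfl
  nonneg := fun i => by
    split_ifs <;> linarith
  gap := fun i j hi hj => by simp [hi, hj, h]
  norm_eq_one := hx
  eigenvector := fun i hi => by
    rw [spikedCov_mulVec, real_inner_self_eq_norm_sq, hx, ← add_smul]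
    simp [hi]

/-- A Gaussian vector with spiked covariance is white noise plus an independent Gaussian multiple
of the spike. -/
lemma multivariateGaussian_spikedCov_eq_map (h₂ : 0 ≤ l₂) (h : l₂ ≤ l₁) :
    multivariateGaussian 0 (spikedCov l₁ l₂ x)
      = (gaussianProd (Fin n)).map
          (fun p => √l₂ • WithLp.toLp 2 p.2 + (√(l₁ - l₂) * p.1) • x) := by
  have hconv : (gaussianProd (Fin n)).map
          (fun p => √l₂ • WithLp.toLp 2 p.2 + (√(l₁ - l₂) * p.1) • x)
      = ((gaussianReal 0 1).map (fun g => (√(l₁ - l₂) * g) • x)).conv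
        ((stdGaussian (EuclideanSpace ℝ (Fin n))).map (fun z => √l₂ • z)) := by
    rw [Measure.conv, ← map_pi_eq_stdGaussian, Measure.map_map (by fun_prop) (by fun_prop),
      Measure.map_prod_map _ _ (by fun_prop) (by fun_prop), Measure.map_map (by fun_prop)
      (by fun_prop)]
    unfold gaussianProd
    congr 1
    ext p : 1
    simp [add_comm]
  rw [hconv]
  -- Both sides have characteristic function `exp(-((l₁ - l₂)⟪x, t⟫² + l₂‖t‖²)/2)`.
  apply Measure.ext_of_charFun
  ext t
  have hmap : (gaussianReal 0 1).map (fun g => (√(l₁ - l₂) * g) • x)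
      = (gaussianReal 0 1).map
        ((ContinuousLinearMap.id ℝ ℝ).smulRight (√(l₁ - l₂) • x)) := by
    congr 1
    ext g : 1
    simp [smul_smul, mul_comm]
  rw [charFun_multivariateGaussian (posSemidef_spikedCov h₂ h), charFun_conv, charFun_map_smul,
    charFun_stdGaussian, hmap, charFun_eq_charFunDual_toDualMap, charFunDual_map,
    charFunDual_eq_charFun_map_one, gaussianReal_map_continuousLinearMap, charFun_gaussianReal,
    ← Complex.exp_add, dotProduct_spikedCov_mulVec]
  congr 1
  have e1 : (√(l₁ - l₂)) ^ 2 = l₁ - l₂ := Real.sq_sqrt (by linarith)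
  have e2 : (√l₂) ^ 2 = l₂ := Real.sq_sqrt h₂
  simp [norm_smul, mul_pow, real_inner_comm x t]
  rw [max_eq_left (by positivity), ← Complex.ofReal_pow |√l₂|, sq_abs, e1, e2]
  push_cast
  ring

lemma integral_inner_multivariateGaussian (u : EuclideanSpace ℝ (Fin n))
    (S : Matrix (Fin n) (Fin n) ℝ) : ∫ y, ⟪u, y⟫ ∂multivariateGaussian 0 S = 0 := by
  have := (innerSL ℝ u).integral_comp_id_comm
    (IsGaussian.integrable_id (μ := multivariateGaussian 0 S))
  simpa using this

lemma map_inner_multivariateGaussian (h₂ : 0 ≤ l₂) (h : l₂ ≤ l₁) (u : EuclideanSpace ℝ (Fin n)) :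
    (multivariateGaussian 0 (spikedCov l₁ l₂ x)).map (fun y => ⟪u, y⟫)
      = gaussianReal 0 (u.ofLp ⬝ᵥ (spikedCov l₁ l₂ x).mulVec u.ofLp).toNNReal := by
  have h1 := IsGaussian.map_eq_gaussianReal (μ := multivariateGaussian 0 (spikedCov l₁ l₂ x))
    (innerSL ℝ u)
  have h2 : (fun y => ⟪u, y⟫) = innerSL ℝ u := by ext; simp
  rw [h2, h1, ← h2]
  congr 1
  · exact integral_inner_multivariateGaussian u _
  · rw [← covarianceBilin_multivariateGaussian (μ := 0) (posSemidef_spikedCov h₂ h),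
      covarianceBilin_self IsGaussian.memLp_two_id]

lemma integrable_inner_mul_inner (u v : EuclideanSpace ℝ (Fin n)) (S : Matrix (Fin n) (Fin n) ℝ) :
    Integrable (fun y => ⟪u, y⟫ * ⟪v, y⟫) (multivariateGaussian 0 S) := by
  have hL : ∀ u : EuclideanSpace ℝ (Fin n),
      MemLp (fun y => ⟪u, y⟫) 2 (multivariateGaussian 0 S) := fun u =>
    IsGaussian.memLp_dual (multivariateGaussian 0 S) (innerSL ℝ u) 2 (by simp)
  exact (hL u).integrable_mul (hL v)

lemma integral_inner_mul_inner (h₂ : 0 ≤ l₂) (h : l₂ ≤ l₁) (u v : EuclideanSpace ℝ (Fin n)) :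
    ∫ y, ⟪u, y⟫ * ⟪v, y⟫ ∂multivariateGaussian 0 (spikedCov l₁ l₂ x)
      = u.ofLp ⬝ᵥ (spikedCov l₁ l₂ x).mulVec v.ofLp := by
  rw [← covarianceBilin_multivariateGaussian (μ := 0) (posSemidef_spikedCov h₂ h),
    covarianceBilin_apply_eq_cov IsGaussian.memLp_two_id, covariance,
    integral_inner_multivariateGaussian, integral_inner_multivariateGaussian]
  simp

lemma sampleCov_apply {m : ℕ} (xs : Fin m → EuclideanSpace ℝ (Fin n)) (i j : Fin n) :
    sampleCov xs i j = (m : ℝ)⁻¹ * ∑ a, xs a i * xs a j := by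
  simp [sampleCov, outerSelf, Matrix.vecMulVec_apply, Matrix.sum_apply]

lemma measurable_sampleCov {m : ℕ} : Measurable (sampleCov (n := n) (m := m)) := by
  refine measurable_pi_lambda _ fun i => measurable_pi_lambda _ fun j => ?_
  simp only [sampleCov_apply]
  fun_prop

lemma mean_spikedSampleCovLaw (h₂ : 0 ≤ l₂) (h : l₂ ≤ l₁) {m : ℕ} (hm : 0 < m) (i j : Fin n) :
    Integrable (fun V : Matrix (Fin n) (Fin n) ℝ => V i j) (spikedSampleCovLaw l₁ l₂ m x) ∧
      ∫ V, V i j ∂(spikedSampleCovLaw l₁ l₂ m x) = spikedCov l₁ l₂ x i j := by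
  have hev : Measurable fun V : Matrix (Fin n) (Fin n) ℝ => V i j :=
    (measurable_pi_apply j).comp (measurable_pi_apply i)
  have hint : ∀ a : Fin m, Integrable (fun xs : Fin m → EuclideanSpace ℝ (Fin n) =>
      xs a i * xs a j) (Measure.pi fun _ => multivariateGaussian 0 (spikedCov l₁ l₂ x)) := by
    intro a
    have := integrable_inner_mul_inner (EuclideanSpace.single i 1) (EuclideanSpace.single j 1)
      (spikedCov l₁ l₂ x)
    simp only [EuclideanSpace.inner_single_left, map_one, one_mul] at this
    exact (measurePreserving_eval (fun _ : Fin m =>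
      multivariateGaussian 0 (spikedCov l₁ l₂ x)) a).integrable_comp_of_integrable this
  have hval : ∀ a : Fin m, ∫ xs : Fin m → EuclideanSpace ℝ (Fin n), xs a i * xs a j
      ∂(Measure.pi fun _ => multivariateGaussian 0 (spikedCov l₁ l₂ x)) = spikedCov l₁ l₂ x i j := by
    intro a
    have := integral_inner_mul_inner (x := x) h₂ h (EuclideanSpace.single i 1)
      (EuclideanSpace.single j 1)
    simp only [EuclideanSpace.inner_single_left, map_one, one_mul] at this
    rw [integral_comp_eval (μ := fun _ : Fin m => multivariateGaussian 0 (spikedCov l₁ l₂ x))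
      (f := fun y : EuclideanSpace ℝ (Fin n) => y i * y j) (by fun_prop), this]
    simp
  constructor
  · rw [spikedSampleCovLaw, integrable_map_measure hev.aestronglyMeasurable
      measurable_sampleCov.aemeasurable]
    simp only [Function.comp_def, sampleCov_apply]
    exact (integrable_finsetSum _ fun a _ => hint a).const_mul _
  · rw [spikedSampleCovLaw, integral_map measurable_sampleCov.aemeasurable
      hev.aestronglyMeasurable]
    simp only [sampleCov_apply]
    rw [integral_const_mul, integral_finsetSum _ fun a _ => hint a]
    simp only [hval]
    have : (m : ℝ) ≠ 0 := by positivity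
    simp [this]

end Spiked

/-! ### The bilinear perturbation bound -/

section Perturbation

variable {n m : ℕ} {l₁ l₂ : ℝ} {x : EuclideanSpace ℝ (Fin n)}

/-- The joint law of the `m` independent samples. -/
noncomputable abbrev spikedSampleLaw (l₁ l₂ : ℝ) (m : ℕ) (x : EuclideanSpace ℝ (Fin n)) :
    Measure (Fin m → EuclideanSpace ℝ (Fin n)) :=
  Measure.pi fun _ : Fin m => multivariateGaussian 0 (spikedCov l₁ l₂ x)

/-- The centered empirical second moment in direction `w`. -/
noncomputable def centeredQuadratic (l₁ l₂ : ℝ) (x w : EuclideanSpace ℝ (Fin n))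
    (xs : Fin m → EuclideanSpace ℝ (Fin n)) : ℝ :=
  ∑ i, (⟪w, xs i⟫ ^ 2 - w.ofLp ⬝ᵥ (spikedCov l₁ l₂ x).mulVec w.ofLp)

lemma lintegral_exp_centered_sq_le (h₂ : 0 ≤ l₂) (h : l₂ ≤ l₁) (hx : ‖x‖ = 1)
    {w : EuclideanSpace ℝ (Fin n)} (hw : ‖w‖ ≤ 2) {t : ℝ} (ht : |t| * (4 * l₁) ≤ 1 / 4) :
    ∫⁻ y, ENNReal.ofReal (Real.exp (t * (⟪w, y⟫ ^ 2
        - w.ofLp ⬝ᵥ (spikedCov l₁ l₂ x).mulVec w.ofLp)))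
        ∂multivariateGaussian 0 (spikedCov l₁ l₂ x)
      ≤ ENNReal.ofReal (Real.exp (4 * t ^ 2 * (4 * l₁) ^ 2)) := by
  set s := w.ofLp ⬝ᵥ (spikedCov l₁ l₂ x).mulVec w.ofLp with hs
  have hs0 : 0 ≤ s := by
    have := (posSemidef_spikedCov (x := x) h₂ h).dotProduct_mulVec_nonneg w.ofLp
    rwa [star_trivial] at this
  have hs1 : s ≤ 4 * l₁ := by
    refine (dotProduct_spikedCov_self_le h hx w).trans ?_
    have : ‖w‖ ^ 2 ≤ 4 := by nlinarith [norm_nonneg w]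
    nlinarith
  have h1 := lintegral_exp_sq_sub_gaussianReal_le s.toNNReal (t := t)
    (by rw [Real.coe_toNNReal _ hs0]; exact (by gcongr : |t| * s ≤ |t| * (4 * l₁)).trans ht)
  rw [← map_inner_multivariateGaussian h₂ h, lintegral_map (by fun_prop) (by fun_prop),
    Real.coe_toNNReal _ hs0] at h1
  refine h1.trans (ENNReal.ofReal_le_ofReal (Real.exp_le_exp.2 ?_))
  gcongr

lemma measure_centeredQuadratic_ge_le (h₂ : 0 ≤ l₂) (h : l₂ ≤ l₁) (hx : ‖x‖ = 1)
    {w : EuclideanSpace ℝ (Fin n)} (hw : ‖w‖ ≤ 2) {t : ℝ} (ht0 : 0 ≤ t)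
    (ht : t * (4 * l₁) ≤ 1 / 4) (τ : ℝ) :
    spikedSampleLaw l₁ l₂ m x {xs | τ ≤ |centeredQuadratic l₁ l₂ x w xs|}
      ≤ ENNReal.ofReal (2 * Real.exp (m * (4 * t ^ 2 * (4 * l₁) ^ 2) - t * τ)) := by
  have key : ∀ s : ℝ, |s| = t →
      spikedSampleLaw l₁ l₂ m x {xs | t * τ ≤ s * centeredQuadratic l₁ l₂ x w xs}
      ≤ ENNReal.ofReal (Real.exp (m * (4 * t ^ 2 * (4 * l₁) ^ 2) - t * τ)) := by
    intro s hs
    have h1 := lintegral_exp_centered_sq_le (x := x) h₂ h hx hw (t := s) (by rwa [hs])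
    rw [← sq_abs s, hs] at h1
    have h2 := pi_sum_ge_le_exp _ (by fun_prop) h1 m (t * τ)
    simp_rw [← Finset.mul_sum] at h2
    exact h2
  have hsub : {xs : Fin m → EuclideanSpace ℝ (Fin n) | τ ≤ |centeredQuadratic l₁ l₂ x w xs|}
      ⊆ {xs | t * τ ≤ t * centeredQuadratic l₁ l₂ x w xs}
        ∪ {xs | t * τ ≤ (-t) * centeredQuadratic l₁ l₂ x w xs} := by
    intro xs hxs
    rcases le_abs.1 (Set.mem_ofPred.1 hxs) with h1 | h1
    · left; exact mul_le_mul_of_nonneg_left h1 ht0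
    · right
      have := mul_le_mul_of_nonneg_left h1 ht0
      simp only [Set.mem_ofPred_eq]; linarith
  calc _ ≤ _ := measure_mono hsub
    _ ≤ _ := measure_union_le _ _
    _ ≤ _ := add_le_add (key t (abs_of_nonneg ht0)) (key (-t) (by rw [abs_neg, abs_of_nonneg ht0]))
    _ = _ := by rw [← ENNReal.ofReal_add (by positivity) (by positivity), two_mul]

lemma sampleCov_mulVec (xs : Fin m → EuclideanSpace ℝ (Fin n)) (v : EuclideanSpace ℝ (Fin n)) :
    (sampleCov xs).mulVec v.ofLp = (m : ℝ)⁻¹ • ∑ i, ⟪xs i, v⟫ • (xs i).ofLp := by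
  rw [sampleCov, Matrix.smul_mulVec, Matrix.sum_mulVec]
  simp_rw [outerSelf_mulVec]

/-- Polarization, which reduces the bilinear form of the error to centered sums of squares, the only
statistic with a Chernoff bound here. -/
lemma dotProduct_error_mulVec (hm : 0 < m) (u v : EuclideanSpace ℝ (Fin n))
    (xs : Fin m → EuclideanSpace ℝ (Fin n)) :
    u.ofLp ⬝ᵥ (sampleCov xs - spikedCov l₁ l₂ x).mulVec v.ofLp
      = (centeredQuadratic l₁ l₂ x (u + v) xs - centeredQuadratic l₁ l₂ x (u - v) xs)
        / (4 * m) := by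
  have hm' : (m : ℝ) ≠ 0 := by positivity
  rw [eq_div_iff (by positivity), Matrix.sub_mulVec, dotProduct_sub, dotProduct_spikedCov_mulVec,
    sampleCov_mulVec, dotProduct_smul, dotProduct_sum, centeredQuadratic, centeredQuadratic,
    ← Finset.sum_sub_distrib]
  simp_rw [dotProduct_spikedCov_mulVec, dotProduct_smul, ← real_inner_eq_dotProduct,
    inner_add_left, inner_sub_left, inner_add_right, inner_sub_right, smul_eq_mul]
  have h1 : ∀ i, (⟪u, xs i⟫ + ⟪v, xs i⟫) ^ 2
        - ((l₁ - l₂) * (⟪x, u⟫ + ⟪x, v⟫) * (⟪x, u⟫ + ⟪x, v⟫)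
          + l₂ * (⟪u, u⟫ + ⟪u, v⟫ + (⟪v, u⟫ + ⟪v, v⟫)))
        - ((⟪u, xs i⟫ - ⟪v, xs i⟫) ^ 2
        - ((l₁ - l₂) * (⟪x, u⟫ - ⟪x, v⟫) * (⟪x, u⟫ - ⟪x, v⟫)
          + l₂ * (⟪u, u⟫ - ⟪u, v⟫ - (⟪v, u⟫ - ⟪v, v⟫))))
      = 4 * (⟪xs i, v⟫ * ⟪u, xs i⟫) - 4 * ((l₁ - l₂) * ⟪x, u⟫ * ⟪x, v⟫ + l₂ * ⟪u, v⟫) := by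
    intro i
    rw [real_inner_comm u v, real_inner_comm v (xs i)]
    ring
  simp_rw [h1]
  rw [Finset.sum_sub_distrib, ← Finset.mul_sum]
  simp
  field_simp

/-- By homogeneity it suffices to control unit vectors, whose sum and difference have norm at most
2; this is the origin of the condition `‖w‖ ≤ 2` above. -/
lemma abs_dotProduct_error_le_of_centeredQuadratic (hm : 0 < m) {ε C : ℝ}
    (u v : EuclideanSpace ℝ (Fin n)) (xs : Fin m → EuclideanSpace ℝ (Fin n)) (hCε : 0 ≤ C * ε)
    (h₁ : |centeredQuadratic l₁ l₂ x (‖u‖⁻¹ • u + ‖v‖⁻¹ • v) xs| < m * (C * ε))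
    (h₂ : |centeredQuadratic l₁ l₂ x (‖u‖⁻¹ • u - ‖v‖⁻¹ • v) xs| < m * (C * ε)) :
    |u.ofLp ⬝ᵥ (sampleCov xs - spikedCov l₁ l₂ x).mulVec v.ofLp| ≤ C * ε * ‖u‖ * ‖v‖ := by
  have hm' : (0 : ℝ) < m := by exact_mod_cast hm
  rcases eq_or_ne u 0 with rfl | hu
  · simp
  rcases eq_or_ne v 0 with rfl | hv
  · simp
  have hu' : ‖u‖ ≠ 0 := norm_ne_zero_iff.2 hu
  have hv' : ‖v‖ ≠ 0 := norm_ne_zero_iff.2 hv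
  have h3 := dotProduct_error_mulVec (l₁ := l₁) (l₂ := l₂) (x := x) hm (‖u‖⁻¹ • u) (‖v‖⁻¹ • v) xs
  have h4 : u.ofLp ⬝ᵥ (sampleCov xs - spikedCov l₁ l₂ x).mulVec v.ofLp
      = ‖u‖ * ‖v‖ * ((‖u‖⁻¹ • u).ofLp ⬝ᵥ
          (sampleCov xs - spikedCov l₁ l₂ x).mulVec (‖v‖⁻¹ • v).ofLp) := by
    simp only [WithLp.ofLp_smul, Matrix.mulVec_smul, smul_dotProduct, dotProduct_smul, smul_eq_mul]
    field_simp
  rw [h4, h3, abs_mul, abs_of_nonneg (by positivity : 0 ≤ ‖u‖ * ‖v‖), abs_div,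
    abs_of_pos (by positivity : (0 : ℝ) < 4 * m)]
  have h5 := abs_sub (centeredQuadratic l₁ l₂ x (‖u‖⁻¹ • u + ‖v‖⁻¹ • v) xs)
    (centeredQuadratic l₁ l₂ x (‖u‖⁻¹ • u - ‖v‖⁻¹ • v) xs)
  have h6 : |centeredQuadratic l₁ l₂ x (‖u‖⁻¹ • u + ‖v‖⁻¹ • v) xs
      - centeredQuadratic l₁ l₂ x (‖u‖⁻¹ • u - ‖v‖⁻¹ • v) xs| / (4 * m) ≤ C * ε := by
    rw [div_le_iff₀ (by positivity)]
    nlinarith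
  calc _ ≤ ‖u‖ * ‖v‖ * (C * ε) := by gcongr
    _ = _ := by ring

/-- The constant in the bilinear perturbation bound. -/
noncomputable def bilinearConst (l₁ a : ℝ) : ℝ := 24 * l₁ / (min 1 (√a) / 4)

lemma bilinearConst_pos {l₁ a : ℝ} (hl : 0 < l₁) (ha : 0 < a) : 0 < bilinearConst l₁ a := by
  have : 0 < min 1 (√a) := lt_min one_pos (Real.sqrt_pos.2 ha)
  unfold bilinearConst; positivity

lemma measure_centeredQuadratic_ge_le_rpow (h₂ : 0 < l₂) (h : l₂ ≤ l₁) (hx : ‖x‖ = 1) {a N : ℝ}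
    (ha : 0 < a) (hN : 1 < N) (hm : 0 < m) (ham : a * Real.log N ≤ m)
    {w : EuclideanSpace ℝ (Fin n)} (hw : ‖w‖ ≤ 2) :
    spikedSampleLaw l₁ l₂ m x {xs | m * (bilinearConst l₁ a * √(Real.log N / m))
        ≤ |centeredQuadratic l₁ l₂ x w xs|}
      ≤ ENNReal.ofReal (2 * (N ^ 5)⁻¹) := by
  have hm' : (0 : ℝ) < m := by exact_mod_cast hm
  have hl : 0 < l₁ := h₂.trans_le h
  have hlog : 0 < Real.log N := Real.log_pos hN
  set δ : ℝ := min 1 (√a) / 4 with hδ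
  have hmin : 0 < min 1 (√a) := lt_min one_pos (Real.sqrt_pos.2 ha)
  have hδ0 : 0 < δ := by positivity
  have hδ1 : δ ≤ 1 / 4 := by
    have := min_le_left 1 (√a)
    linarith
  set ε : ℝ := √(Real.log N / m) with hε
  have hε0 : 0 ≤ ε := Real.sqrt_nonneg _
  have hε2 : ε ^ 2 = Real.log N / m := Real.sq_sqrt (by positivity)
  have hδε : δ * ε ≤ 1 / 4 := by
    have h1 : √a * ε ≤ 1 := by
      rw [hε, ← Real.sqrt_mul ha.le, Real.sqrt_le_iff, ← mul_div_assoc, one_pow, div_le_one hm']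
      exact ⟨zero_le_one, ham⟩
    have h2 : min 1 (√a) * ε ≤ √a * ε := by gcongr; exact min_le_right _ _
    rw [hδ]; linarith
  -- The assumption `a log N ≤ m` makes `δ ε ≤ 1/4`, so this Chernoff parameter is admissible. The
  -- factor 24 in the constant turns the exponent into `(4δ² - 6) log N ≤ -5 log N`.
  have h1 := measure_centeredQuadratic_ge_le (m := m) h₂.le h hx hw
    (t := δ * ε / (4 * l₁)) (by positivity)
    (by rw [div_mul_cancel₀ _ (by positivity)]; exact hδε) (m * (bilinearConst l₁ a * ε))
  refine h1.trans (ENNReal.ofReal_le_ofReal ?_)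
  gcongr
  have h2 : m * (4 * (δ * ε / (4 * l₁)) ^ 2 * (4 * l₁) ^ 2)
      - δ * ε / (4 * l₁) * (m * (bilinearConst l₁ a * ε)) = (4 * δ ^ 2 - 6) * Real.log N := by
    have h3 : m * ε ^ 2 = Real.log N := by rw [hε2]; field_simp
    rw [← h3, bilinearConst, ← hδ]
    field_simp
    ring
  rw [h2]
  calc _ ≤ Real.exp (-(5 * Real.log N)) := by
        apply Real.exp_le_exp.2
        have : δ ^ 2 ≤ 1 / 4 := by nlinarith
        nlinarith
    _ = _ := by
        rw [Real.exp_neg]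
        congr 1
        have := Real.exp_nat_mul (Real.log N) 5
        push_cast at this
        rw [this, Real.exp_log (by linarith)]

/-- A union bound over `N` pairs, each with two vectors failing with probability at most `2N⁻⁵`. -/
lemma measure_not_bilinear_le (h₂ : 0 < l₂) (h : l₂ ≤ l₁) (hx : ‖x‖ = 1) {a : ℝ}
    (ha : 0 < a) (hm : 0 < m) (S₁ S₂ : Finset (EuclideanSpace ℝ (Fin n)))
    (hN : 1 < (S₁.card : ℝ) * (S₂.card : ℝ))
    (ham : a * Real.log ((S₁.card : ℝ) * (S₂.card : ℝ)) ≤ m) :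
    spikedSampleLaw l₁ l₂ m x {xs | ¬ ∀ s₁ ∈ S₁, ∀ s₂ ∈ S₂,
        |s₁.ofLp ⬝ᵥ (sampleCov xs - spikedCov l₁ l₂ x).mulVec s₂.ofLp| ≤
          bilinearConst l₁ a * √(Real.log ((S₁.card : ℝ) * (S₂.card : ℝ)) / (m : ℝ))
            * ‖s₁‖ * ‖s₂‖}
      ≤ ENNReal.ofReal (4 * (((S₁.card : ℝ) * (S₂.card : ℝ)) ^ 4)⁻¹) := by
  set N : ℝ := (S₁.card : ℝ) * (S₂.card : ℝ) with hNdef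
  set τ : ℝ := m * (bilinearConst l₁ a * √(Real.log N / m)) with hτ
  let bad : EuclideanSpace ℝ (Fin n) → Set (Fin m → EuclideanSpace ℝ (Fin n)) :=
    fun w => {xs | τ ≤ |centeredQuadratic l₁ l₂ x w xs|}
  have hunit : ∀ u : EuclideanSpace ℝ (Fin n), ‖‖u‖⁻¹ • u‖ ≤ 1 := fun u => by
    rw [norm_smul, norm_inv, norm_norm]
    exact inv_mul_le_one
  have hbad : ∀ w : EuclideanSpace ℝ (Fin n), ‖w‖ ≤ 2 →
      spikedSampleLaw l₁ l₂ m x (bad w) ≤ ENNReal.ofReal (2 * (N ^ 5)⁻¹) := fun w hw =>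
    measure_centeredQuadratic_ge_le_rpow h₂ h hx ha hN hm ham hw
  have hsub : {xs : Fin m → EuclideanSpace ℝ (Fin n) | ¬ ∀ s₁ ∈ S₁, ∀ s₂ ∈ S₂,
        |s₁.ofLp ⬝ᵥ (sampleCov xs - spikedCov l₁ l₂ x).mulVec s₂.ofLp| ≤
          bilinearConst l₁ a * √(Real.log N / (m : ℝ)) * ‖s₁‖ * ‖s₂‖}
      ⊆ ⋃ p ∈ S₁ ×ˢ S₂, (bad (‖p.1‖⁻¹ • p.1 + ‖p.2‖⁻¹ • p.2)
          ∪ bad (‖p.1‖⁻¹ • p.1 - ‖p.2‖⁻¹ • p.2)) := by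
    intro xs hxs
    by_contra hcon
    simp only [Set.mem_iUnion, not_exists, Set.mem_union, not_or] at hcon
    refine hxs fun s₁ hs₁ s₂ hs₂ => ?_
    have := hcon (s₁, s₂) (Finset.mk_mem_product hs₁ hs₂)
    refine abs_dotProduct_error_le_of_centeredQuadratic hm s₁ s₂ xs ?_
      (not_le.1 this.1) (not_le.1 this.2)
    have := bilinearConst_pos (h₂.trans_le h) ha
    positivity
  calc _ ≤ _ := measure_mono hsub
    _ ≤ _ := measure_biUnion_finset_le _ _
    _ ≤ ∑ _p ∈ S₁ ×ˢ S₂, ENNReal.ofReal (4 * (N ^ 5)⁻¹) := by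
        refine Finset.sum_le_sum fun p _ => (measure_union_le _ _).trans ?_
        calc _ ≤ ENNReal.ofReal (2 * (N ^ 5)⁻¹) + ENNReal.ofReal (2 * (N ^ 5)⁻¹) := by
              gcongr
              · exact hbad _ ((norm_add_le _ _).trans (by linarith [hunit p.1, hunit p.2]))
              · exact hbad _ ((norm_sub_le _ _).trans (by linarith [hunit p.1, hunit p.2]))
          _ = _ := by
              rw [← ENNReal.ofReal_add (by positivity) (by positivity)]; congr 1; ring
    _ = _ := by
        rw [Finset.sum_const, Finset.card_product, nsmul_eq_mul, ← ENNReal.ofReal_natCast,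
          ← ENNReal.ofReal_mul (by positivity)]
        congr 1
        push_cast
        rw [← hNdef]
        have : N ≠ 0 := by linarith
        field_simp

end Perturbation

/-! ### The spectral perturbation bound and the combined estimate -/

section Spectral

variable {n m : ℕ} {l₁ l₂ : ℝ} {x : EuclideanSpace ℝ (Fin n)}

/-- Nearly orthogonal vectors of bounded length satisfy a Bessel-type upper bound. -/
lemma norm_sum_smul_sq_le {A : ℝ} (hA : 0 ≤ A) (xs : Fin m → EuclideanSpace ℝ (Fin n))
    {D : ℝ} (hdiag : ∀ i, ‖xs i‖ ^ 2 ≤ D)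
    (hoff : ∑ i, ∑ j, (if i = j then 0 else ⟪xs i, xs j⟫ ^ 2) ≤ A ^ 2) (c : Fin m → ℝ) :
    ‖∑ i, c i • xs i‖ ^ 2 ≤ (D + A) * ∑ i, c i ^ 2 := by
  have hc : 0 ≤ ∑ i, c i ^ 2 := Finset.sum_nonneg fun i _ => sq_nonneg _
  have hexp : ‖∑ i, c i • xs i‖ ^ 2 = ∑ i, c i ^ 2 * ‖xs i‖ ^ 2
      + ∑ p : Fin m × Fin m, (c p.1 * c p.2) * (if p.1 = p.2 then 0 else ⟪xs p.1, xs p.2⟫) := by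
    rw [← real_inner_self_eq_norm_sq, sum_inner, Fintype.sum_prod_type, ← Finset.sum_add_distrib]
    refine Finset.sum_congr rfl fun i _ => ?_
    rw [inner_sum, ← Finset.add_sum_erase _ _ (Finset.mem_univ i),
      ← Finset.add_sum_erase Finset.univ
        (fun j => c i * c j * (if i = j then 0 else ⟪xs i, xs j⟫)) (Finset.mem_univ i)]
    simp only [inner_smul_left, inner_smul_right, real_inner_self_eq_norm_sq, if_true, mul_zero,
      zero_add, RCLike.conj_to_real]
    congr 1
    · ring
    · refine Finset.sum_congr rfl fun j hj => ?_
      rw [if_neg (Finset.ne_of_mem_erase hj).symm]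
      ring
  have h1 : ∑ i, c i ^ 2 * ‖xs i‖ ^ 2 ≤ D * ∑ i, c i ^ 2 := by
    rw [Finset.mul_sum]
    refine Finset.sum_le_sum fun i _ => ?_
    rw [mul_comm]
    exact mul_le_mul_of_nonneg_right (hdiag i) (sq_nonneg _)
  -- Cauchy-Schwarz over index pairs: the Hilbert-Schmidt norm of the off-diagonal Gram matrix
  -- bounds its quadratic form.
  have h2 : (∑ p : Fin m × Fin m, (c p.1 * c p.2)
      * (if p.1 = p.2 then 0 else ⟪xs p.1, xs p.2⟫)) ^ 2 ≤ ((∑ i, c i ^ 2) * A) ^ 2 := by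
    refine (Finset.sum_mul_sq_le_sq_mul_sq _ _ _).trans ?_
    rw [mul_pow]
    gcongr
    · rw [Fintype.sum_prod_type, sq, Finset.sum_mul_sum]
      simp [mul_pow]
    · rw [Fintype.sum_prod_type]
      simpa [ite_pow] using hoff
  have h3 := abs_le_of_sq_le_sq' h2 (by positivity)
  rw [hexp]
  linarith [h3.2]

lemma norm_toEuclideanCLM_error_le (h₂ : 0 < l₂) (h : l₂ ≤ l₁) (hx : ‖x‖ = 1) (hm : 0 < m)
    (hmn : m ≤ n) (xs : Fin m → EuclideanSpace ℝ (Fin n))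
    (hdiag : ∀ i, ‖xs i‖ ^ 2 ≤ 4 * l₁ * n)
    (hoff : ∑ i, ∑ j, (if i = j then 0 else ⟪xs i, xs j⟫ ^ 2) ≤ (l₁ * n) ^ 2) :
    ‖Matrix.toEuclideanCLM (𝕜 := ℝ) (sampleCov xs - spikedCov l₁ l₂ x)‖
      ≤ 6 * l₁ * ((n : ℝ) / (m : ℝ)) := by
  have hl : 0 < l₁ := h₂.trans_le h
  have hm' : (0 : ℝ) < m := by exact_mod_cast hm
  refine ContinuousLinearMap.opNorm_le_bound _ (by positivity) fun u => ?_
  set y : EuclideanSpace ℝ (Fin n) := ∑ i, ⟪xs i, u⟫ • xs i with hy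
  have h1 : Matrix.toEuclideanCLM (𝕜 := ℝ) (sampleCov xs - spikedCov l₁ l₂ x) u
      = (m : ℝ)⁻¹ • y - (((l₁ - l₂) * ⟪x, u⟫) • x + l₂ • u) := by
    apply WithLp.ofLp_injective
    rw [Matrix.ofLp_toEuclideanCLM, Matrix.sub_mulVec, sampleCov_mulVec, spikedCov_mulVec]
    simp [hy, WithLp.ofLp_sum]
  -- Applying the Bessel bound with coefficients `⟪xs i, u⟫` gives `‖y‖² ≤ 5 l₁ n ⟪y, u⟫`;
  -- Cauchy-Schwarz then cancels one factor `‖y‖`.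
  have hys : ‖y‖ ≤ 5 * l₁ * n * ‖u‖ := by
    have h2 := norm_sum_smul_sq_le (by positivity) xs hdiag hoff (fun i => ⟪xs i, u⟫)
    have h3 : ∑ i, ⟪xs i, u⟫ ^ 2 = ⟪y, u⟫ := by
      rw [hy, sum_inner]
      exact Finset.sum_congr rfl fun i _ => by rw [real_inner_smul_left, sq]
    rw [h3, ← hy] at h2
    have h4 := real_inner_le_norm y u
    have h5 : ‖y‖ ^ 2 ≤ 5 * l₁ * n * ‖u‖ * ‖y‖ := by
      have h6 : (4 * l₁ * n + l₁ * n) * ⟪y, u⟫ ≤ (4 * l₁ * n + l₁ * n) * (‖y‖ * ‖u‖) := by gcongr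
      linarith
    rcases eq_or_ne ‖y‖ 0 with h0 | h0
    · rw [h0]; positivity
    · have : 0 < ‖y‖ := lt_of_le_of_ne (norm_nonneg _) h0.symm
      rw [sq] at h5
      exact le_of_mul_le_mul_right h5 this
  have hS : ‖((l₁ - l₂) * ⟪x, u⟫) • x + l₂ • u‖ ≤ l₁ * ‖u‖ := by
    refine (norm_add_le _ _).trans ?_
    have h2 := abs_real_inner_le_norm x u
    rw [hx, one_mul] at h2
    rw [norm_smul, norm_smul, hx, mul_one, Real.norm_eq_abs, Real.norm_eq_abs, abs_mul,
      abs_of_nonneg (sub_nonneg.2 h), abs_of_pos h₂]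
    nlinarith [mul_le_mul_of_nonneg_left h2 (sub_nonneg.2 h)]
  rw [h1]
  refine (norm_sub_le _ _).trans ?_
  rw [norm_smul, norm_inv, Real.norm_eq_abs, abs_of_pos hm']
  have hnm : (1 : ℝ) ≤ n / m := by
    rw [one_le_div hm']; exact_mod_cast hmn
  calc (m : ℝ)⁻¹ * ‖y‖ + ‖((l₁ - l₂) * ⟪x, u⟫) • x + l₂ • u‖
      ≤ (m : ℝ)⁻¹ * (5 * l₁ * n * ‖u‖) + l₁ * ‖u‖ * (n / m) := by
        gcongr
        exact hS.trans (le_mul_of_one_le_right (by positivity) hnm)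
    _ = _ := by field_simp; ring

/-- Chernoff with parameter 1/4: each coordinate contributes at most `e^{1/2}`, against a threshold
of `n`. -/
lemma stdGaussian_norm_sq_ge_le :
    stdGaussian (EuclideanSpace ℝ (Fin n)) {z | 4 * (n : ℝ) ≤ ‖z‖ ^ 2}
      ≤ ENNReal.ofReal (Real.exp (-(n / 2))) := by
  rw [← map_pi_eq_stdGaussian, Measure.map_apply (by fun_prop)
    (measurableSet_le measurable_const (by fun_prop))]
  have h1 : ∫⁻ z, ENNReal.ofReal (Real.exp (1 / 4 * z ^ 2)) ∂gaussianReal 0 1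
      ≤ ENNReal.ofReal (Real.exp (1 / 2)) := by
    rw [lintegral_exp_mul_sq_gaussianReal (by norm_num)]
    apply ENNReal.ofReal_le_ofReal
    refine (one_div_sqrt_one_sub_le_exp (by norm_num [abs_of_pos])).trans ?_
    norm_num
  have h2 := pi_sum_ge_le_exp _ (by fun_prop) h1 n n
  have hset : (WithLp.toLp 2) ⁻¹' {z : EuclideanSpace ℝ (Fin n) | 4 * (n : ℝ) ≤ ‖z‖ ^ 2}
      = {z : Fin n → ℝ | (n : ℝ) ≤ ∑ i, 1 / 4 * z i ^ 2} := by
    ext z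
    simp only [Set.mem_preimage, Set.mem_ofPred_eq, EuclideanSpace.real_norm_sq_eq]
    rw [← Finset.mul_sum]
    constructor <;> intro h <;> linarith
  rw [hset]
  refine h2.trans (le_of_eq ?_)
  congr 2
  ring

open scoped MatrixOrder in
lemma norm_toEuclideanCLM_sqrt_sq_le (h₂ : 0 ≤ l₂) (h : l₂ ≤ l₁) (hx : ‖x‖ = 1)
    (z : EuclideanSpace ℝ (Fin n)) :
    ‖Matrix.toEuclideanCLM (𝕜 := ℝ) (CFC.sqrt (spikedCov l₁ l₂ x)) z‖ ^ 2 ≤ l₁ * ‖z‖ ^ 2 := by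
  refine le_trans (le_of_eq ?_) (dotProduct_spikedCov_self_le (l₂ := l₂) h hx z)
  have hS := posSemidef_spikedCov (x := x) h₂ h
  have hsq : CFC.sqrt (spikedCov l₁ l₂ x) * CFC.sqrt (spikedCov l₁ l₂ x) = spikedCov l₁ l₂ x :=
    CFC.sqrt_mul_sqrt_self _ hS.nonneg
  have hsa : IsSelfAdjoint (CFC.sqrt (spikedCov l₁ l₂ x)) := (CFC.sqrt_nonneg _).isSelfAdjoint
  have hT : (CFC.sqrt (spikedCov l₁ l₂ x)).transpose = CFC.sqrt (spikedCov l₁ l₂ x) := by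
    have := hsa.star_eq
    rwa [Matrix.star_eq_conjTranspose, Matrix.conjTranspose_eq_transpose_of_trivial] at this
  rw [← real_inner_self_eq_norm_sq, real_inner_eq_dotProduct, Matrix.ofLp_toEuclideanCLM]
  conv_rhs => rw [← hsq, ← Matrix.mulVec_mulVec, Matrix.dotProduct_mulVec,
    ← Matrix.mulVec_transpose, hT]

open scoped MatrixOrder in
lemma measure_norm_sq_gt_le (h₂ : 0 < l₂) (h : l₂ ≤ l₁) (hx : ‖x‖ = 1) :
    multivariateGaussian 0 (spikedCov l₁ l₂ x) {y | 4 * l₁ * n < ‖y‖ ^ 2}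
      ≤ ENNReal.ofReal (Real.exp (-(n / 2))) := by
  rw [multivariateGaussian, Measure.map_apply (by fun_prop)
    (measurableSet_lt measurable_const (by fun_prop))]
  refine (measure_mono fun z hz => ?_).trans stdGaussian_norm_sq_ge_le
  have hz' : 4 * l₁ * n < ‖0 + Matrix.toEuclideanCLM (𝕜 := ℝ) (CFC.sqrt (spikedCov l₁ l₂ x)) z‖ ^ 2
    := hz
  rw [zero_add] at hz'
  have h3 := hz'.trans_le (norm_toEuclideanCLM_sqrt_sq_le h₂.le h hx z)
  have hl : 0 < l₁ := h₂.trans_le h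
  have : l₁ * (4 * (n : ℝ)) ≤ l₁ * ‖z‖ ^ 2 := by linarith
  exact le_of_mul_le_mul_left this hl

lemma lintegral_inner_sq (h₂ : 0 ≤ l₂) (h : l₂ ≤ l₁) (u : EuclideanSpace ℝ (Fin n)) :
    ∫⁻ y, ENNReal.ofReal (⟪u, y⟫ ^ 2) ∂multivariateGaussian 0 (spikedCov l₁ l₂ x)
      = ENNReal.ofReal (u.ofLp ⬝ᵥ (spikedCov l₁ l₂ x).mulVec u.ofLp) := by
  rw [← integral_inner_mul_inner h₂ h, ofReal_integral_eq_lintegral_ofReal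
    (integrable_inner_mul_inner u u _) (Filter.Eventually.of_forall fun y => mul_self_nonneg _)]
  simp_rw [sq]

lemma lintegral_norm_sq_le (h₂ : 0 ≤ l₂) (h : l₂ ≤ l₁) (hx : ‖x‖ = 1) :
    ∫⁻ y, ENNReal.ofReal (‖y‖ ^ 2) ∂multivariateGaussian 0 (spikedCov l₁ l₂ x)
      ≤ ENNReal.ofReal (n * l₁) := by
  have hl : 0 ≤ l₁ := h₂.trans h
  have h1 : ∀ y : EuclideanSpace ℝ (Fin n), ENNReal.ofReal (‖y‖ ^ 2)
      = ∑ i, ENNReal.ofReal (⟪EuclideanSpace.single i (1 : ℝ), y⟫ ^ 2) := by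
    intro y
    rw [← ENNReal.ofReal_sum_of_nonneg fun i _ => sq_nonneg _, EuclideanSpace.real_norm_sq_eq]
    simp [EuclideanSpace.inner_single_left]
  simp_rw [h1]
  rw [lintegral_finsetSum _ fun i _ => by fun_prop]
  calc _ ≤ ∑ _i : Fin n, ENNReal.ofReal l₁ := by
        refine Finset.sum_le_sum fun i _ => ?_
        rw [lintegral_inner_sq h₂ h]
        apply ENNReal.ofReal_le_ofReal
        refine (dotProduct_spikedCov_self_le h hx _).trans ?_
        simp
    _ = _ := by
        rw [Finset.sum_const, Finset.card_univ, Fintype.card_fin, nsmul_eq_mul,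
          ENNReal.ofReal_mul (by positivity), ENNReal.ofReal_natCast]

/-- Given one sample `y`, the inner product with an independent one has variance at most `l₁‖y‖²`,
of mean at most `n l₁²`. Typical off-diagonal Gram entries are thus of order `√n`, not `n`. -/
lemma lintegral_inner_sq_pi_le (h₂ : 0 ≤ l₂) (h : l₂ ≤ l₁) (hx : ‖x‖ = 1) {i j : Fin m}
    (hij : i ≠ j) :
    ∫⁻ xs, ENNReal.ofReal (⟪xs i, xs j⟫ ^ 2) ∂spikedSampleLaw l₁ l₂ m x
      ≤ ENNReal.ofReal (n * l₁ ^ 2) := by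
  have hl : 0 ≤ l₁ := h₂.trans h
  set μ := multivariateGaussian 0 (spikedCov l₁ l₂ x) with hμ
  have hind : IndepFun (fun xs : Fin m → EuclideanSpace ℝ (Fin n) => xs i) (fun xs => xs j)
      (spikedSampleLaw l₁ l₂ m x) :=
    (iIndepFun_pi (μ := fun _ : Fin m => μ) (X := fun _ y => y)
      fun _ => measurable_id.aemeasurable).indepFun hij
  have hmap := (indepFun_iff_map_prod_eq_prod_map_map (measurable_pi_apply i).aemeasurable
    (measurable_pi_apply j).aemeasurable).1 hind
  have hi := (measurePreserving_eval (fun _ : Fin m => μ) i).map_eq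
  have hj := (measurePreserving_eval (fun _ : Fin m => μ) j).map_eq
  have h1 : ∫⁻ xs, ENNReal.ofReal (⟪xs i, xs j⟫ ^ 2) ∂spikedSampleLaw l₁ l₂ m x
      = ∫⁻ p, ENNReal.ofReal (⟪p.1, p.2⟫ ^ 2) ∂(μ.prod μ) := by
    have : μ.prod μ = (spikedSampleLaw l₁ l₂ m x).map (fun xs => (xs i, xs j)) := by
      rw [hmap]
      exact (congrArg₂ Measure.prod hi hj).symm
    rw [this, lintegral_map (by fun_prop) (by fun_prop)]
  rw [h1, lintegral_prod _ (by fun_prop)]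
  calc _ ≤ ∫⁻ y, ENNReal.ofReal l₁ * ENNReal.ofReal (‖y‖ ^ 2) ∂μ := by
        refine lintegral_mono fun y => ?_
        rw [hμ]
        simp only
        rw [lintegral_inner_sq h₂ h, ← ENNReal.ofReal_mul hl]
        exact ENNReal.ofReal_le_ofReal (dotProduct_spikedCov_self_le h hx y)
    _ ≤ ENNReal.ofReal l₁ * ENNReal.ofReal (n * l₁) := by
        rw [lintegral_const_mul _ (by fun_prop)]
        gcongr
        exact lintegral_norm_sq_le h₂ h hx
    _ = _ := by
        rw [← ENNReal.ofReal_mul hl]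
        congr 1
        ring

lemma measure_offDiagonal_gt_le (h₂ : 0 < l₂) (h : l₂ ≤ l₁) (hx : ‖x‖ = 1) (hn : 0 < n) :
    spikedSampleLaw l₁ l₂ m x
        {xs | (l₁ * n) ^ 2 < ∑ i, ∑ j, (if i = j then 0 else ⟪xs i, xs j⟫ ^ 2)}
      ≤ ENNReal.ofReal (m ^ 2 / n) := by
  have hl : 0 < l₁ := h₂.trans_le h
  have hn' : (0 : ℝ) < n := by exact_mod_cast hn
  have hmeas : ∀ i j : Fin m, Measurable fun xs : Fin m → EuclideanSpace ℝ (Fin n) =>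
      ENNReal.ofReal (if i = j then 0 else ⟪xs i, xs j⟫ ^ 2) := fun i j => by
    split_ifs <;> fun_prop
  have hsum : ∀ xs : Fin m → EuclideanSpace ℝ (Fin n),
      ENNReal.ofReal (∑ i, ∑ j, (if i = j then 0 else ⟪xs i, xs j⟫ ^ 2))
        = ∑ i, ∑ j, ENNReal.ofReal (if i = j then 0 else ⟪xs i, xs j⟫ ^ 2) := by
    intro xs
    have h0 : ∀ i j, 0 ≤ if i = j then 0 else ⟪xs i, xs j⟫ ^ 2 := fun i j => by
      split_ifs <;> positivity
    rw [ENNReal.ofReal_sum_of_nonneg fun i _ => Finset.sum_nonneg fun j _ => h0 i j]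
    exact Finset.sum_congr rfl fun i _ => ENNReal.ofReal_sum_of_nonneg fun j _ => h0 i j
  have hint : ∫⁻ xs, ENNReal.ofReal (∑ i, ∑ j, (if i = j then 0 else ⟪xs i, xs j⟫ ^ 2))
      ∂spikedSampleLaw l₁ l₂ m x ≤ ENNReal.ofReal (m ^ 2 * (n * l₁ ^ 2)) := by
    simp_rw [hsum]
    rw [lintegral_finsetSum _ fun i _ => Finset.measurable_sum _ fun j _ => hmeas i j]
    simp_rw [lintegral_finsetSum _ fun j _ => hmeas _ j]
    calc _ ≤ ∑ _i : Fin m, ∑ _j : Fin m, ENNReal.ofReal (n * l₁ ^ 2) := by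
          refine Finset.sum_le_sum fun i _ => Finset.sum_le_sum fun j _ => ?_
          split_ifs with hij
          · simp
          · exact lintegral_inner_sq_pi_le h₂.le h hx hij
      _ = _ := by
          simp only [Finset.sum_const, Finset.card_univ, Fintype.card_fin, nsmul_eq_mul]
          rw [ENNReal.ofReal_mul (p := (m : ℝ) ^ 2) (by positivity),
            ENNReal.ofReal_pow (p := (m : ℝ)) (by positivity), ENNReal.ofReal_natCast]
          ring
  have hmk := mul_meas_ge_le_lintegral₀ (μ := spikedSampleLaw l₁ l₂ m x)
    (f := fun xs => ENNReal.ofReal (∑ i, ∑ j, (if i = j then 0 else ⟪xs i, xs j⟫ ^ 2)))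
    (by simp_rw [hsum]; exact (Finset.measurable_sum _ fun i _ =>
      Finset.measurable_sum _ fun j _ => hmeas i j).aemeasurable)
    (ENNReal.ofReal ((l₁ * n) ^ 2))
  have hpos : 0 < (l₁ * n) ^ 2 := by positivity
  have h1 : (m : ℝ) ^ 2 / n = m ^ 2 * (n * l₁ ^ 2) / (l₁ * n) ^ 2 := by
    field_simp
  rw [h1, ENNReal.ofReal_div_of_pos hpos, ENNReal.le_div_iff_mul_le
    (.inl (ENNReal.ofReal_pos.2 hpos).ne') (.inl (by simp)), mul_comm]
  refine le_trans ?_ (hmk.trans hint)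
  gcongr
  exact fun hxs => ENNReal.ofReal_le_ofReal (le_of_lt hxs)

/-- The crude failure bound `(2m + m²)/n` suffices since `n` is exponentially large in `m`. -/
lemma measure_not_spectral_le (h₂ : 0 < l₂) (h : l₂ ≤ l₁) (hx : ‖x‖ = 1) (hm : 0 < m)
    (hn : 12 * (m : ℝ) ^ 2 * Real.exp m ≤ n) :
    spikedSampleLaw l₁ l₂ m x {xs | ¬ ‖Matrix.toEuclideanCLM (𝕜 := ℝ)
        (sampleCov xs - spikedCov l₁ l₂ x)‖ ≤ 6 * l₁ * ((n : ℝ) / (m : ℝ))}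
      ≤ ENNReal.ofReal (Real.exp (-m) / 4) := by
  have hm1 : (1 : ℝ) ≤ m := by exact_mod_cast hm
  have hexp : 1 ≤ Real.exp m := Real.one_le_exp (by positivity)
  have hmn : (m : ℝ) ≤ n := by nlinarith
  have hn0 : (0 : ℝ) < n := by linarith
  have hsub : {xs : Fin m → EuclideanSpace ℝ (Fin n) | ¬ ‖Matrix.toEuclideanCLM (𝕜 := ℝ)
        (sampleCov xs - spikedCov l₁ l₂ x)‖ ≤ 6 * l₁ * ((n : ℝ) / (m : ℝ))}
      ⊆ (⋃ i, (fun xs => xs i) ⁻¹' {y | 4 * l₁ * n < ‖y‖ ^ 2})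
        ∪ {xs | (l₁ * n) ^ 2 < ∑ i, ∑ j, (if i = j then 0 else ⟪xs i, xs j⟫ ^ 2)} := by
    intro xs hxs
    by_contra hcon
    simp only [Set.mem_union, Set.mem_iUnion, Set.mem_preimage, Set.mem_ofPred_eq, not_or,
      not_exists, not_lt] at hcon
    exact hxs (norm_toEuclideanCLM_error_le h₂ h hx hm (by exact_mod_cast hmn) xs hcon.1 hcon.2)
  have hdiag : ∀ i : Fin m, spikedSampleLaw l₁ l₂ m x
      ((fun xs => xs i) ⁻¹' {y | 4 * l₁ * n < ‖y‖ ^ 2}) ≤ ENNReal.ofReal (2 / n) := by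
    intro i
    have h1 := (measurePreserving_eval (fun _ : Fin m =>
      multivariateGaussian 0 (spikedCov l₁ l₂ x)) i).measure_preimage
      (s := {y | 4 * l₁ * n < ‖y‖ ^ 2})
      (measurableSet_lt measurable_const (by fun_prop)).nullMeasurableSet
    refine (h1.le.trans (measure_norm_sq_gt_le h₂ h hx)).trans (ENNReal.ofReal_le_ofReal ?_)
    rw [Real.exp_neg, show (2 : ℝ) / n = ((n : ℝ) / 2)⁻¹ from (inv_div _ _).symm]
    gcongr
    linarith [Real.add_one_le_exp ((n : ℝ) / 2)]
  calc _ ≤ _ := measure_mono hsub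
    _ ≤ _ := measure_union_le _ _
    _ ≤ ∑ _i : Fin m, ENNReal.ofReal (2 / n) + ENNReal.ofReal (m ^ 2 / n) := by
        gcongr
        · exact (measure_iUnion_fintype_le _ _).trans (Finset.sum_le_sum fun i _ => hdiag i)
        · exact measure_offDiagonal_gt_le h₂ h hx (by exact_mod_cast hn0)
    _ = ENNReal.ofReal (m * (2 / n) + m ^ 2 / n) := by
        rw [Finset.sum_const, Finset.card_univ, Fintype.card_fin, nsmul_eq_mul,
          ENNReal.ofReal_add (by positivity) (by positivity), ENNReal.ofReal_mul (by positivity),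
          ENNReal.ofReal_natCast]
    _ ≤ _ := by
        apply ENNReal.ofReal_le_ofReal
        have h1 : (m : ℝ) * (2 / n) + m ^ 2 / n = (2 * m + m ^ 2) / n := by ring
        rw [h1, div_le_iff₀ hn0]
        calc (2 * m + m ^ 2 : ℝ) ≤ 3 * m ^ 2 := by nlinarith
          _ = Real.exp (-m) / 4 * (12 * (m : ℝ) ^ 2 * Real.exp m) := by
              rw [Real.exp_neg]; field_simp; ring
          _ ≤ _ := by gcongr

/-- The constant in the perturbation bounds. -/
noncomputable def perturbationConst (l₁ a : ℝ) : ℝ := max (bilinearConst l₁ a) (6 * l₁)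

lemma spikedSampleCovLaw_smallPerturbation_ge (h₂ : 0 < l₂) (h : l₂ ≤ l₁) (hx : ‖x‖ = 1)
    (hm : 0 < m) (hn : 12 * (m : ℝ) ^ 2 * Real.exp m ≤ n) {a : ℝ} (ha : 0 < a)
    (S₁ S₂ : Finset (EuclideanSpace ℝ (Fin n)))
    (ham : a * Real.log ((S₁.card : ℝ) * (S₂.card : ℝ)) ≤ (m : ℝ)) :
    1 - Real.exp (-(min a 1 * Real.log ((S₁.card : ℝ) * (S₂.card : ℝ))))
        - Real.exp (-(min a 1 * (n : ℝ))) ≤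
      (spikedSampleCovLaw l₁ l₂ m x).real
        {V | SmallPerturbation (perturbationConst l₁ a) m S₁ S₂ (V - spikedCov l₁ l₂ x)} := by
  have hprob : IsProbabilityMeasure (spikedSampleCovLaw l₁ l₂ m x) :=
    Measure.isProbabilityMeasure_map measurable_sampleCov.aemeasurable
  set N : ℝ := (S₁.card : ℝ) * (S₂.card : ℝ) with hN
  have hNnat : N = ((S₁.card * S₂.card : ℕ) : ℝ) := by push_cast; rfl
  -- Here the logarithm vanishes (for an empty set by `Real.log 0 = 0`), so the claimed lower bound
  -- is negative.
  rcases le_or_gt (S₁.card * S₂.card) 1 with hcard | hcard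
  · have hlog : Real.log N = 0 := by
      rw [hNnat]
      interval_cases S₁.card * S₂.card <;> simp
    rw [hlog, mul_zero, neg_zero, Real.exp_zero]
    have := Real.exp_pos (-(min a 1 * (n : ℝ)))
    have := measureReal_nonneg (μ := spikedSampleCovLaw l₁ l₂ m x) (s :=
      {V | SmallPerturbation (perturbationConst l₁ a) m S₁ S₂ (V - spikedCov l₁ l₂ x)})
    linarith
  have hN2 : 2 ≤ N := by rw [hNnat]; exact_mod_cast hcard
  have hlog : 0 < Real.log N := Real.log_pos (by linarith)
  set good := {V | SmallPerturbation (perturbationConst l₁ a) m S₁ S₂ (V - spikedCov l₁ l₂ x)}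
    with hgood
  set B : Set (Fin m → EuclideanSpace ℝ (Fin n)) := {xs | ¬ ∀ s₁ ∈ S₁, ∀ s₂ ∈ S₂,
        |s₁.ofLp ⬝ᵥ (sampleCov xs - spikedCov l₁ l₂ x).mulVec s₂.ofLp| ≤
          bilinearConst l₁ a * √(Real.log N / (m : ℝ)) * ‖s₁‖ * ‖s₂‖} with hB
  set D : Set (Fin m → EuclideanSpace ℝ (Fin n)) := {xs | ¬ ‖Matrix.toEuclideanCLM (𝕜 := ℝ)
        (sampleCov xs - spikedCov l₁ l₂ x)‖ ≤ 6 * l₁ * ((n : ℝ) / (m : ℝ))} with hD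
  -- A covering and subadditivity replace complements, so the good event need not be shown
  -- measurable.
  have hcover : (Set.univ : Set (Fin m → EuclideanSpace ℝ (Fin n)))
      ⊆ sampleCov ⁻¹' good ∪ (B ∪ D) := by
    intro xs _
    by_contra hcon
    simp only [hB, hD, Set.mem_union, Set.mem_ofPred_eq, not_or, not_not] at hcon
    refine hcon.1 ⟨fun s₁ hs₁ s₂ hs₂ => (hcon.2.1 s₁ hs₁ s₂ hs₂).trans ?_, hcon.2.2.trans ?_⟩
    · gcongr; exact le_max_left _ _
    · gcongr; exact le_max_right _ _
  have h1 : (1 : ENNReal) ≤ spikedSampleCovLaw l₁ l₂ m x good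
      + (ENNReal.ofReal (4 * (N ^ 4)⁻¹) + ENNReal.ofReal (Real.exp (-m) / 4)) := by
    calc (1 : ENNReal) = spikedSampleLaw l₁ l₂ m x Set.univ := measure_univ.symm
      _ ≤ _ := measure_mono hcover
      _ ≤ _ := measure_union_le _ _
      _ ≤ _ := by
        gcongr
        · exact Measure.le_map_apply measurable_sampleCov.aemeasurable _
        · refine (measure_union_le _ _).trans ?_
          gcongr
          · exact measure_not_bilinear_le h₂ h hx ha hm S₁ S₂ (by linarith) ham
          · exact measure_not_spectral_le h₂ h hx hm hn
  have h2 : 1 ≤ (spikedSampleCovLaw l₁ l₂ m x).real good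
      + (4 * (N ^ 4)⁻¹ + Real.exp (-m) / 4) := by
    rw [← ENNReal.ofReal_add (by positivity) (by positivity), ← ofReal_measureReal,
      ← ENNReal.ofReal_add (by positivity) (by positivity), ← ENNReal.ofReal_one] at h1
    exact (ENNReal.ofReal_le_ofReal_iff (by positivity)).1 h1
  -- The bilinear failure needs `c ≤ 1` and the spectral one `c ≤ a`. They cost a half and a quarter
  -- of `exp(-c log N)`, so the term in `n` is pure slack.
  set c := min a 1 with hc
  have hNinv : Real.exp (-Real.log N) = N⁻¹ := by
    rw [Real.exp_neg, Real.exp_log (by linarith)]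
  have h3 : 4 * (N ^ 4)⁻¹ ≤ Real.exp (-(c * Real.log N)) / 2 := by
    calc 4 * (N ^ 4)⁻¹ ≤ N⁻¹ / 2 := by
          have h8 : (8 : ℝ) ≤ N ^ 3 := by
            calc (8 : ℝ) = 2 ^ 3 := by norm_num
              _ ≤ _ := by gcongr
          have hN0 : 0 < N := by linarith
          rw [show N ^ 4 = N ^ 3 * N by ring, mul_inv, ← mul_assoc]
          have : 4 * (N ^ 3)⁻¹ ≤ 1 / 2 := by
            rw [← div_eq_mul_inv, div_le_iff₀ (by positivity)]
            linarith
          have := mul_le_mul_of_nonneg_right this (inv_pos.2 hN0).le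
          linarith
      _ = Real.exp (-Real.log N) / 2 := by rw [hNinv]
      _ ≤ _ := by
          gcongr
          exact mul_le_of_le_one_left hlog.le (min_le_right _ _)
  have h4 : Real.exp (-m) ≤ Real.exp (-(c * Real.log N)) := by
    apply Real.exp_le_exp.2
    have : c * Real.log N ≤ a * Real.log N := by gcongr; exact min_le_left _ _
    linarith
  have := Real.exp_pos (-(c * (n : ℝ)))
  have := Real.exp_pos (-(c * Real.log N))
  linarith

end Spectral

/-! ### Packing a Euclidean ball -/

section Packing

/-- Volumetric lower bound for the packing number of a Euclidean ball. -/
lemma exists_separated_finset_closedBall (k : ℕ) {r ε : ℝ} (hr : 0 < r) (hε : 0 < ε) :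
    ∃ C : Finset (EuclideanSpace ℝ (Fin k)), (∀ z ∈ C, z ∈ Metric.closedBall 0 r) ∧
      (∀ z ∈ C, ∀ z' ∈ C, z ≠ z' → ε < dist z z') ∧ (r / ε) ^ k ≤ C.card := by
  set A := Metric.closedBall (0 : EuclideanSpace ℝ (Fin k)) r with hA
  have hcomp : IsCompact A := isCompact_closedBall _ _
  set e : NNReal := (ε / 2).toNNReal with he
  have he2 : ((2 * e : NNReal) : ℝ) = ε := by
    rw [NNReal.coe_mul, he, Real.coe_toNNReal _ (by positivity), NNReal.coe_ofNat]; ring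
  -- A finite cover at scale `ε/2` bounds the packing number at scale `ε`; finiteness is what makes
  -- the maximal separated set a genuine maximizer.
  have hfin : Metric.packingNumber (2 * e) A ≠ ⊤ := by
    obtain ⟨N, hN, hNfin, hcov⟩ := Metric.exists_finite_isCover_of_isCompact (ε := e)
      (Real.toNNReal_pos.2 (by positivity)).ne' hcomp
    have h1 := Metric.packingNumber_two_mul_le_externalCoveringNumber e A
    have h2 : Metric.externalCoveringNumber e A ≤ N.encard :=
      Metric.IsCover.externalCoveringNumber_le_encard hcov
    exact ((h1.trans h2).trans_lt hNfin.encard_lt_top).ne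
  have hmaxcov := Metric.isCover_maximalSeparatedSet hfin
  have hfinmax : (Metric.maximalSeparatedSet (2 * e) A).Finite := by
    rw [← Set.encard_ne_top_iff, Metric.encard_maximalSeparatedSet hfin]; exact hfin
  refine ⟨hfinmax.toFinset, fun z hz => Metric.maximalSeparatedSet_subset (by simpa using hz),
    fun z hz z' hz' hne => ?_, ?_⟩
  · have : ((2 * e : NNReal) : ENNReal) < edist z z' := Metric.isSeparated_maximalSeparatedSet (hfinmax.mem_toFinset.1 hz)
      (hfinmax.mem_toFinset.1 hz') hne
    rw [edist_nndist, ENNReal.coe_lt_coe, ← NNReal.coe_lt_coe, he2] at this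
    exact this
  -- By maximality the `ε`-balls around the points cover, so their volumes add up to at least that
  -- of the `r`-ball.
  · rw [Metric.isCover_iff_subset_iUnion_closedBall, he2] at hmaxcov
    have hvol : volume A ≤ ∑ y ∈ hfinmax.toFinset, volume (Metric.closedBall y ε) := by
      refine (measure_mono (hmaxcov.trans ?_)).trans (measure_biUnion_finset_le _ _)
      simp
    simp only [hA, Measure.addHaar_closedBall _ _ hr.le, Measure.addHaar_closedBall _ _ hε.le,
      Finset.sum_const, nsmul_eq_mul, finrank_euclideanSpace_fin] at hvol
    rw [← mul_assoc, ENNReal.mul_le_mul_iff_left (Metric.measure_ball_pos _ _ one_pos).ne'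
      measure_ball_lt_top.ne, ← ENNReal.ofReal_natCast, ← ENNReal.ofReal_mul (by positivity),
      ENNReal.ofReal_le_ofReal_iff (by positivity)] at hvol
    rwa [div_pow, div_le_iff₀ (by positivity)]

end Packing

/-! ### The Lipschitz generator built from tents -/

section Generator

variable {E F J : Type*} [PseudoMetricSpace E] [NormedAddCommGroup F] [InnerProductSpace ℝ F]

/-- The tent function of height one and radius `ε` centered at `c`. -/
noncomputable def tent (ε : ℝ) (c z : E) : ℝ := max (1 - dist z c / ε) 0

lemma tent_nonneg (ε : ℝ) (c z : E) : 0 ≤ tent ε c z := le_max_right _ _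

lemma tent_le_one {ε : ℝ} (hε : 0 < ε) (c z : E) : tent ε c z ≤ 1 := by
  have : 0 ≤ dist z c / ε := by positivity
  exact max_le (by linarith) zero_le_one

lemma tent_self (ε : ℝ) (c : E) : tent ε c c = 1 := by simp [tent]

lemma dist_lt_of_tent_ne_zero {ε : ℝ} (hε : 0 < ε) {c z : E} (h : tent ε c z ≠ 0) :
    dist z c < ε := by
  by_contra! hcon
  refine h (max_eq_right ?_)
  rw [sub_nonpos]
  exact (one_le_div hε).2 hcon

lemma abs_tent_sub_tent_le {ε : ℝ} (hε : 0 < ε) (c z z' : E) :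
    |tent ε c z - tent ε c z'| ≤ dist z z' / ε := by
  refine (abs_max_sub_max_le_abs _ _ _).trans ?_
  rw [show 1 - dist z c / ε - (1 - dist z' c / ε) = -((dist z c - dist z' c) / ε) by ring,
    abs_neg, abs_div, abs_of_pos hε]
  gcongr
  exact abs_dist_sub_le _ _ _

lemma tent_eq_zero_of_ne {ε : ℝ} (hε : 0 < ε) {c : J → E}
    (hc : ∀ i j, i ≠ j → 2 * ε < dist (c i) (c j)) {z : E} {i j : J} (hij : i ≠ j)
    (h : tent ε (c i) z ≠ 0) : tent ε (c j) z = 0 := by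
  by_contra hj
  have h1 := dist_lt_of_tent_ne_zero hε h
  have h2 := dist_lt_of_tent_ne_zero hε hj
  have h3 := dist_triangle_left (c i) (c j) z
  linarith [hc i j hij]

variable [Fintype J]

lemma card_tent_ne_zero_le_one {ε : ℝ} (hε : 0 < ε) {c : J → E}
    (hc : ∀ i j, i ≠ j → 2 * ε < dist (c i) (c j)) (z : E) :
    (Finset.univ.filter fun j => tent ε (c j) z ≠ 0).card ≤ 1 := by
  refine Finset.card_le_one.2 fun i hi j hj => ?_
  by_contra hij
  exact (Finset.mem_filter.1 hj).2 (tent_eq_zero_of_ne hε hc hij (Finset.mem_filter.1 hi).2)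

lemma sum_tent_sq_le_one {ε : ℝ} (hε : 0 < ε) {c : J → E}
    (hc : ∀ i j, i ≠ j → 2 * ε < dist (c i) (c j)) (z : E) :
    ∑ j, tent ε (c j) z ^ 2 ≤ 1 := by
  classical
  have h1 : ∑ j, tent ε (c j) z ^ 2
      = ∑ j ∈ Finset.univ.filter (fun j => tent ε (c j) z ≠ 0), tent ε (c j) z ^ 2 := by
    rw [Finset.sum_filter_of_ne]
    intro j _ hj h0
    simp [h0] at hj
  rw [h1]
  refine (Finset.sum_le_card_nsmul _ _ 1 fun j _ =>
    pow_le_one₀ (tent_nonneg _ _ _) (tent_le_one hε _ _)).trans ?_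
  have := card_tent_ne_zero_le_one hε hc z
  simp only [nsmul_eq_mul, mul_one]
  exact_mod_cast this

/-- At most one tent is active at each of the two points, hence the factor 2. -/
lemma sum_tent_sub_sq_le {ε : ℝ} (hε : 0 < ε) {c : J → E}
    (hc : ∀ i j, i ≠ j → 2 * ε < dist (c i) (c j)) (z z' : E) :
    ∑ j, (tent ε (c j) z - tent ε (c j) z') ^ 2 ≤ 2 * (dist z z' / ε) ^ 2 := by
  classical
  set A := (Finset.univ.filter fun j => tent ε (c j) z ≠ 0)
    ∪ Finset.univ.filter (fun j => tent ε (c j) z' ≠ 0) with hA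
  have h1 : ∑ j, (tent ε (c j) z - tent ε (c j) z') ^ 2
      = ∑ j ∈ A, (tent ε (c j) z - tent ε (c j) z') ^ 2 := by
    refine (Finset.sum_subset (Finset.subset_univ A) fun j _ hj => ?_).symm
    simp only [hA, Finset.mem_union, Finset.mem_filter, Finset.mem_univ, true_and, not_or,
      not_not] at hj
    simp [hj.1, hj.2]
  rw [h1]
  have hcard : (A.card : ℝ) ≤ 2 := by
    have := Finset.card_union_le (Finset.univ.filter fun j => tent ε (c j) z ≠ 0)
      (Finset.univ.filter fun j => tent ε (c j) z' ≠ 0)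
    have h2 := card_tent_ne_zero_le_one hε hc z
    have h3 := card_tent_ne_zero_le_one hε hc z'
    rw [← hA] at this
    exact_mod_cast (by omega : A.card ≤ 2)
  refine (Finset.sum_le_card_nsmul _ _ ((dist z z' / ε) ^ 2) fun j _ => ?_).trans ?_
  · rw [← sq_abs]
    gcongr
    exact abs_tent_sub_tent_le hε _ _ _
  · rw [nsmul_eq_mul]
    gcongr

/-- The tents of height `δ` over the centers `c`, in orthogonal directions. -/
noncomputable def tentSum (b : Option J → F) (δ ε : ℝ) (c : J → E) (z : E) : F :=
  ∑ j, (δ * tent ε (c j) z) • b (some j)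

/-- The map into the unit sphere that follows the north pole `b none`, moved towards `b (some j)`
near the center `c j`. -/
noncomputable def tentGenerator (b : Option J → F) (δ ε : ℝ) (c : J → E) (z : E) : F :=
  √(1 - ‖tentSum b δ ε c z‖ ^ 2) • b none + tentSum b δ ε c z

lemma norm_sum_smul_some_sq {b : Option J → F} (hb : Orthonormal ℝ b) (a : J → ℝ) :
    ‖∑ j, a j • b (some j)‖ ^ 2 = ∑ j, a j ^ 2 := by
  have hb' : Orthonormal ℝ fun j => b (some j) := hb.comp _ (Option.some_injective J)
  rw [← real_inner_self_eq_norm_sq, hb'.inner_sum]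
  simp [sq]

lemma norm_smul_none_add_sq {b : Option J → F} (hb : Orthonormal ℝ b) (s : ℝ) (a : J → ℝ) :
    ‖s • b none + ∑ j, a j • b (some j)‖ ^ 2 = s ^ 2 + ∑ j, a j ^ 2 := by
  have h := hb.inner_sum (fun o : Option J => o.elim s a) (fun o : Option J => o.elim s a)
    Finset.univ
  rw [Fintype.sum_option, Fintype.sum_option, real_inner_self_eq_norm_sq] at h
  simpa [sq] using h

lemma norm_tentSum_sq {b : Option J → F} (hb : Orthonormal ℝ b) (δ ε : ℝ) (c : J → E) (z : E) :
    ‖tentSum b δ ε c z‖ ^ 2 = δ ^ 2 * ∑ j, tent ε (c j) z ^ 2 := by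
  rw [tentSum, norm_sum_smul_some_sq hb, Finset.mul_sum]
  simp_rw [mul_pow]

lemma norm_tentSum_le {b : Option J → F} (hb : Orthonormal ℝ b) {δ ε : ℝ} (hδ : 0 ≤ δ)
    (hε : 0 < ε) {c : J → E} (hc : ∀ i j, i ≠ j → 2 * ε < dist (c i) (c j)) (z : E) : ‖tentSum b δ ε c z‖ ≤ δ := by
  refine (sq_le_sq₀ (norm_nonneg _) hδ).1 ?_
  rw [norm_tentSum_sq hb]
  exact mul_le_of_le_one_right (sq_nonneg _) (sum_tent_sq_le_one hε hc z)

lemma norm_tentGenerator {b : Option J → F} (hb : Orthonormal ℝ b) {δ ε : ℝ} (hδ : 0 ≤ δ)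
    (hδ' : δ ≤ 1) (hε : 0 < ε) {c : J → E} (hc : ∀ i j, i ≠ j → 2 * ε < dist (c i) (c j)) (z : E) :
    ‖tentGenerator b δ ε c z‖ = 1 := by
  have h1 := norm_tentSum_le hb hδ hε hc z
  have h2 : 0 ≤ 1 - ‖tentSum b δ ε c z‖ ^ 2 := by nlinarith [norm_nonneg (tentSum b δ ε c z)]
  rw [← sq_eq_sq₀ (norm_nonneg _) zero_le_one, tentGenerator]
  nth_rw 2 [tentSum]
  rw [norm_smul_none_add_sq hb, ← norm_sum_smul_some_sq hb, ← tentSum, Real.sq_sqrt h2]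
  ring

/-- Multiply by the conjugate: the two roots sum to at least 1, while `s + t ≤ 1`. -/
lemma abs_sqrt_one_sub_sq_sub_le {s t : ℝ} (hs : 0 ≤ s) (hs' : s ≤ 1 / 2) (ht : 0 ≤ t)
    (ht' : t ≤ 1 / 2) : |√(1 - s ^ 2) - √(1 - t ^ 2)| ≤ |s - t| := by
  have hP : 1 / 2 ≤ √(1 - s ^ 2) := Real.le_sqrt_of_sq_le (by nlinarith)
  have hQ : 1 / 2 ≤ √(1 - t ^ 2) := Real.le_sqrt_of_sq_le (by nlinarith)
  have hP2 : √(1 - s ^ 2) ^ 2 = 1 - s ^ 2 := Real.sq_sqrt (by nlinarith)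
  have hQ2 : √(1 - t ^ 2) ^ 2 = 1 - t ^ 2 := Real.sq_sqrt (by nlinarith)
  have h1 : |√(1 - s ^ 2) - √(1 - t ^ 2)| * (√(1 - s ^ 2) + √(1 - t ^ 2)) = |s - t| * (s + t) := by
    rw [← abs_of_nonneg (by linarith : 0 ≤ √(1 - s ^ 2) + √(1 - t ^ 2)), ← abs_mul,
      ← abs_of_nonneg (by linarith : 0 ≤ s + t), ← abs_mul, ← abs_neg]
    congr 1
    linear_combination hQ2 - hP2
  have h2 : |s - t| * (s + t) ≤ |s - t| * 1 := by gcongr; linarith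
  have h3 : |√(1 - s ^ 2) - √(1 - t ^ 2)| * 1
      ≤ |√(1 - s ^ 2) - √(1 - t ^ 2)| * (√(1 - s ^ 2) + √(1 - t ^ 2)) := by gcongr; linarith
  linarith

/-- The polar coordinate moves no more than the tent part, so the squared displacement is at most `2
· δ² · 2 (dist z z' / ε)²`; `δ ≤ 1/2` makes the constant exactly one. -/
lemma norm_tentGenerator_sub_le {b : Option J → F} (hb : Orthonormal ℝ b) {δ ε : ℝ} (hδ : 0 ≤ δ)
    (hδ' : δ ≤ 1 / 2) (hε : 0 < ε) {c : J → E} (hc : ∀ i j, i ≠ j → 2 * ε < dist (c i) (c j))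
    (z z' : E) :
    ‖tentGenerator b δ ε c z - tentGenerator b δ ε c z'‖ ≤ dist z z' / ε := by
  have hd : 0 ≤ dist z z' / ε := by positivity
  have hw : tentSum b δ ε c z - tentSum b δ ε c z'
      = ∑ j, (δ * (tent ε (c j) z - tent ε (c j) z')) • b (some j) := by
    rw [tentSum, tentSum, ← Finset.sum_sub_distrib]
    refine Finset.sum_congr rfl fun j _ => ?_
    rw [← sub_smul, mul_sub]
  have hG : tentGenerator b δ ε c z - tentGenerator b δ ε c z'
      = (√(1 - ‖tentSum b δ ε c z‖ ^ 2) - √(1 - ‖tentSum b δ ε c z'‖ ^ 2)) • b none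
        + (tentSum b δ ε c z - tentSum b δ ε c z') := by
    rw [tentGenerator, tentGenerator, sub_smul]
    abel
  have h1 := abs_sqrt_one_sub_sq_sub_le (norm_nonneg (tentSum b δ ε c z))
    ((norm_tentSum_le hb hδ hε hc z).trans hδ') (norm_nonneg (tentSum b δ ε c z'))
    ((norm_tentSum_le hb hδ hε hc z').trans hδ')
  have h2 := h1.trans (abs_norm_sub_norm_le _ _)
  have h3 := sq_le_sq' (by linarith [abs_nonneg (√(1 - ‖tentSum b δ ε c z‖ ^ 2)
    - √(1 - ‖tentSum b δ ε c z'‖ ^ 2)), norm_nonneg (tentSum b δ ε c z - tentSum b δ ε c z')]) h2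
  rw [sq_abs, hw, norm_sum_smul_some_sq hb] at h3
  simp_rw [mul_pow] at h3
  rw [← Finset.mul_sum] at h3
  have h4 := sum_tent_sub_sq_le hε hc z z'
  rw [← sq_le_sq₀ (norm_nonneg _) hd, hG, hw, norm_smul_none_add_sq hb]
  simp_rw [mul_pow]
  rw [← Finset.mul_sum]
  have h5 : δ ^ 2 ≤ 1 / 4 := by nlinarith
  have h6 : δ ^ 2 * ∑ j, (tent ε (c j) z - tent ε (c j) z') ^ 2
      ≤ 1 / 4 * (2 * (dist z z' / ε) ^ 2) := by gcongr
  linarith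

lemma tentGenerator_center {b : Option J → F} (hb : Orthonormal ℝ b) {δ ε : ℝ} (hε : 0 < ε)
    {c : J → E} (hc : ∀ i j, i ≠ j → 2 * ε < dist (c i) (c j)) (j : J) :
    tentGenerator b δ ε c (c j) = √(1 - δ ^ 2) • b none + δ • b (some j) := by
  have h1 : tentSum b δ ε c (c j) = δ • b (some j) := by
    rw [tentSum, Finset.sum_eq_single j]
    · rw [tent_self, mul_one]
    · intro i _ hi
      rw [tent_eq_zero_of_ne hε hc hi.symm (by rw [tent_self]; exact one_ne_zero), mul_zero,
        zero_smul]
    · simp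
  rw [tentGenerator, h1, norm_smul, hb.1, mul_one, Real.norm_eq_abs, sq_abs]

end Generator

/-! ### Frobenius distance of rank-one projectors -/

section Frobenius

variable {n : ℕ}

lemma frobNorm_eq_norm (A : Matrix (Fin n) (Fin n) ℝ) :
    frobNorm A = ‖WithLp.toLp 2 (fun p : Fin n × Fin n => A p.1 p.2)‖ := by
  rw [EuclideanSpace.norm_eq, frobNorm, Fintype.sum_prod_type]
  simp

lemma frobNorm_nonneg (A : Matrix (Fin n) (Fin n) ℝ) : 0 ≤ frobNorm A := Real.sqrt_nonneg _

lemma frobNorm_sq (A : Matrix (Fin n) (Fin n) ℝ) : frobNorm A ^ 2 = ∑ i, ∑ j, A i j ^ 2 :=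
  Real.sq_sqrt (Finset.sum_nonneg fun _ _ => Finset.sum_nonneg fun _ _ => sq_nonneg _)

lemma frobNorm_sub_le (A B C : Matrix (Fin n) (Fin n) ℝ) :
    frobNorm (A - C) ≤ frobNorm (B - A) + frobNorm (B - C) := by
  simp only [frobNorm_eq_norm]
  refine le_trans (le_of_eq ?_) ((norm_sub_le _ _).trans_eq (add_comm _ _))
  congr 1
  ext p
  simp

lemma frobNorm_outerSelf_sub_sq (x y : EuclideanSpace ℝ (Fin n)) :
    frobNorm (outerSelf x - outerSelf y) ^ 2 = ‖x‖ ^ 4 + ‖y‖ ^ 4 - 2 * ⟪x, y⟫ ^ 2 := by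
  have hx : ‖x‖ ^ 4 = ∑ i, ∑ j, (x i ^ 2) * (x j ^ 2) := by
    rw [← Finset.sum_mul_sum, ← EuclideanSpace.real_norm_sq_eq]; ring
  have hy : ‖y‖ ^ 4 = ∑ i, ∑ j, (y i ^ 2) * (y j ^ 2) := by
    rw [← Finset.sum_mul_sum, ← EuclideanSpace.real_norm_sq_eq]; ring
  have hxy : ⟪x, y⟫ ^ 2 = ∑ i, ∑ j, (x i * y i) * (x j * y j) := by
    rw [← Finset.sum_mul_sum, real_inner_eq_dotProduct, dotProduct]; ring
  rw [frobNorm_sq, hx, hy, hxy]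
  simp_rw [Finset.mul_sum, ← Finset.sum_add_distrib, ← Finset.sum_sub_distrib]
  refine Finset.sum_congr rfl fun i _ => Finset.sum_congr rfl fun j _ => ?_
  simp only [outerSelf, Matrix.sub_apply, Matrix.vecMulVec_apply]
  ring

lemma measurable_frobNorm_outerSelf_sub {X : Type*} [MeasurableSpace X]
    {v : X → EuclideanSpace ℝ (Fin n)} (hv : Measurable v) (x : EuclideanSpace ℝ (Fin n)) :
    Measurable fun V => frobNorm (outerSelf (v V) - outerSelf x) := by
  simp only [frobNorm, outerSelf, Matrix.sub_apply, Matrix.vecMulVec_apply]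
  fun_prop

end Frobenius

/-! ### The minimax lower bound over spikes -/

section LowerBound

variable {n m : ℕ} {l₁ l₂ δ : ℝ} {J : Type*}

/-- The spike in direction `j`, at distance of order `δ` from the north pole `b none`. -/
noncomputable def spike (b : Option J → EuclideanSpace ℝ (Fin n)) (δ : ℝ) (j : J) :
    EuclideanSpace ℝ (Fin n) :=
  √(1 - δ ^ 2) • b none + δ • b (some j)

lemma inner_spike_spike {b : Option J → EuclideanSpace ℝ (Fin n)} (hb : Orthonormal ℝ b)
    (hδ : δ ^ 2 ≤ 1) {i j : J} (hij : i ≠ j) : ⟪spike b δ i, spike b δ j⟫ = 1 - δ ^ 2 := by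
  classical
  have h := orthonormal_iff_ite.1 hb
  simp only [spike, inner_add_left, inner_add_right, inner_smul_left, inner_smul_right, h]
  simp [hij, Real.mul_self_sqrt (sub_nonneg.2 hδ)]

lemma norm_spike {b : Option J → EuclideanSpace ℝ (Fin n)} (hb : Orthonormal ℝ b)
    (hδ : δ ^ 2 ≤ 1) (j : J) : ‖spike b δ j‖ = 1 := by
  classical
  have h := orthonormal_iff_ite.1 hb
  have h1 : ⟪spike b δ j, spike b δ j⟫ = 1 := by
    simp only [spike, inner_add_left, inner_add_right, inner_smul_left, inner_smul_right, h]
    simp [Real.mul_self_sqrt (sub_nonneg.2 hδ)]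
    ring
  rw [real_inner_self_eq_norm_sq] at h1
  exact (pow_eq_one_iff_of_nonneg (norm_nonneg _) two_ne_zero).1 h1

/-- The squared distance is `2 - 2(1 - δ²)² = 4δ² - 2δ⁴`. -/
lemma le_frobNorm_outerSelf_spike_sub {b : Option J → EuclideanSpace ℝ (Fin n)}
    (hb : Orthonormal ℝ b) (hδ0 : 0 ≤ δ) (hδ : δ ≤ 1 / 2) {i j : J} (hij : i ≠ j) :
    δ ≤ frobNorm (outerSelf (spike b δ i) - outerSelf (spike b δ j)) := by
  have hδ2 : δ ^ 2 ≤ 1 := by nlinarith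
  rw [← sq_le_sq₀ hδ0 (frobNorm_nonneg _), frobNorm_outerSelf_sub_sq, norm_spike hb hδ2,
    norm_spike hb hδ2, inner_spike_spike hb hδ2 hij]
  nlinarith [mul_nonneg (sq_nonneg δ) (sub_nonneg.2 hδ2)]

/-- White noise plus a Gaussian multiple of the common part of the spikes. -/
noncomputable def polarSample (l₁ l₂ : ℝ) (p : EuclideanSpace ℝ (Fin n)) (δ : ℝ)
    (q : ℝ × (Fin n → ℝ)) : EuclideanSpace ℝ (Fin n) :=
  √l₂ • WithLp.toLp 2 q.2 + (√(l₁ - l₂) * q.1) • √(1 - δ ^ 2) • p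

lemma measurable_polarSample (l₁ l₂ : ℝ) (p : EuclideanSpace ℝ (Fin n)) (δ : ℝ) :
    Measurable (polarSample l₁ l₂ p δ) := by
  unfold polarSample; fun_prop

/-- The shear of the noise that moves the north pole to the spike in direction `j`. -/
noncomputable def spikeShear (l₁ l₂ : ℝ) (b : Option J → EuclideanSpace ℝ (Fin n)) (δ : ℝ)
    (j : J) : Fin n → ℝ :=
  ((√(l₁ - l₂) / √l₂ * δ) • b (some j)).ofLp

lemma sum_spikeShear_sq (h₂ : 0 < l₂) (h : l₂ ≤ l₁) {b : Option J → EuclideanSpace ℝ (Fin n)}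
    (hb : Orthonormal ℝ b) (j : J) :
    ∑ i, spikeShear l₁ l₂ b δ j i ^ 2 = (l₁ - l₂) / l₂ * δ ^ 2 := by
  rw [spikeShear, ← EuclideanSpace.real_norm_sq_eq, norm_smul, hb.1, mul_one, Real.norm_eq_abs,
    sq_abs, mul_pow, div_pow, Real.sq_sqrt h₂.le, Real.sq_sqrt (sub_nonneg.2 h)]

/-- The outer map does not depend on `j`; only the shear density does. This lets one reference
measure serve for all hypotheses, with no density of the possibly singular sample covariance. -/
lemma multivariateGaussian_spike_eq_map (h₂ : 0 < l₂) (h : l₂ ≤ l₁)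
    (b : Option J → EuclideanSpace ℝ (Fin n)) (j : J) :
    multivariateGaussian 0 (spikedCov l₁ l₂ (spike b δ j))
      = ((gaussianProd (Fin n)).withDensity (shearDensity (spikeShear l₁ l₂ b δ j))).map
          (polarSample l₁ l₂ (b none) δ) := by
  rw [multivariateGaussian_spikedCov_eq_map h₂.le h, ← gaussianProd_map_shear,
    Measure.map_map (measurable_polarSample _ _ _ _) (by fun_prop)]
  congr 1
  ext q i
  have : √l₂ ≠ 0 := (Real.sqrt_pos.2 h₂).ne'
  simp [polarSample, spikeShear, spike]
  field_simp
  ring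

/-- The likelihood ratio of `m` independent shears. -/
noncomputable def jointShearDensity (m : ℕ) (h : Fin n → ℝ) (q : Fin m → ℝ × (Fin n → ℝ)) :
    ENNReal :=
  ∏ i, shearDensity h (q i)

lemma measurable_jointShearDensity (m : ℕ) (h : Fin n → ℝ) :
    Measurable (jointShearDensity m h) :=
  Finset.measurable_prod _ fun i _ => (measurable_shearDensity h).comp (measurable_pi_apply i)

lemma isProbabilityMeasure_withDensity_shearDensity (h : Fin n → ℝ) :
    IsProbabilityMeasure ((gaussianProd (Fin n)).withDensity (shearDensity h)) := by
  rw [← gaussianProd_map_shear]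
  exact Measure.isProbabilityMeasure_map (by fun_prop)

lemma spikedSampleLaw_spike_eq_map (h₂ : 0 < l₂) (h : l₂ ≤ l₁)
    (b : Option J → EuclideanSpace ℝ (Fin n)) (j : J) :
    spikedSampleLaw l₁ l₂ m (spike b δ j)
      = ((Measure.pi fun _ : Fin m => gaussianProd (Fin n)).withDensity
          (jointShearDensity m (spikeShear l₁ l₂ b δ j))).map
          (fun q i => polarSample l₁ l₂ (b none) δ (q i)) := by
  have := isProbabilityMeasure_withDensity_shearDensity (spikeShear l₁ l₂ b δ j)
  have h1 := pi_withDensity_prod (fun _ : Fin m => gaussianProd (Fin n))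
    (fun _ => measurable_shearDensity (spikeShear l₁ l₂ b δ j))
  have := Measure.isProbabilityMeasure_map (μ := (gaussianProd (Fin n)).withDensity
    (shearDensity (spikeShear l₁ l₂ b δ j))) (measurable_polarSample l₁ l₂ (b none) δ).aemeasurable
  unfold jointShearDensity
  rw [h1, Measure.pi_map_pi fun _ => (measurable_polarSample l₁ l₂ (b none) δ).aemeasurable]
  rw [spikedSampleLaw, multivariateGaussian_spike_eq_map h₂ h]

lemma lintegral_jointShearDensity_sq_le (h : Fin n → ℝ) (hh : ∑ i, h i ^ 2 ≤ 1 / 4) :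
    ∫⁻ q, jointShearDensity m h q ^ 2 ∂(Measure.pi fun _ : Fin m => gaussianProd (Fin n))
      ≤ ENNReal.ofReal (Real.exp (m * (2 * ∑ i, h i ^ 2))) := by
  unfold jointShearDensity
  simp_rw [← Finset.prod_pow]
  rw [lintegral_pi_prod (fun _ : Fin m => gaussianProd (Fin n))
    fun _ => (measurable_shearDensity h).pow_const 2]
  calc _ ≤ ∏ _i : Fin m, ENNReal.ofReal (Real.exp (2 * ∑ i, h i ^ 2)) :=
        Finset.prod_le_prod' fun _ _ => lintegral_shearDensity_sq_le h hh
    _ = _ := by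
      rw [Finset.prod_const, Finset.card_univ, Fintype.card_fin,
        ← ENNReal.ofReal_pow (Real.exp_pos _).le, ← Real.exp_nat_mul]

/-- Minimax lower bound over a family of spikes in orthogonal directions. -/
lemma exists_spike_lintegral_frobNorm_ge [Fintype J] [Nonempty J] (h₂ : 0 < l₂) (h : l₂ ≤ l₁)
    {b : Option J → EuclideanSpace ℝ (Fin n)} (hb : Orthonormal ℝ b) (hδ0 : 0 < δ)
    (hδ : δ ≤ 1 / 2) (hs : (l₁ - l₂) / l₂ * δ ^ 2 ≤ 1 / 4)
    (hJ : 16 * Real.exp (m * (2 * ((l₁ - l₂) / l₂ * δ ^ 2))) ≤ Fintype.card J)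
    {v : Matrix (Fin n) (Fin n) ℝ → EuclideanSpace ℝ (Fin n)} (hv : Measurable v) :
    ∃ j, ENNReal.ofReal (δ / 4) ≤
      ∫⁻ V, ENNReal.ofReal (frobNorm (outerSelf (v V) - outerSelf (spike b δ j)))
        ∂(spikedSampleCovLaw l₁ l₂ m (spike b δ j)) := by
  set Q := Measure.pi fun _ : Fin m => gaussianProd (Fin n)
  set f : J → (Fin m → ℝ × (Fin n → ℝ)) → ENNReal :=
    fun j => jointShearDensity m (spikeShear l₁ l₂ b δ j) with hf
  set T : (Fin m → ℝ × (Fin n → ℝ)) → Matrix (Fin n) (Fin n) ℝ :=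
    fun q => sampleCov fun i => polarSample l₁ l₂ (b none) δ (q i) with hT
  have hpolar : Measurable fun (q : Fin m → ℝ × (Fin n → ℝ)) i =>
      polarSample l₁ l₂ (b none) δ (q i) := measurable_pi_lambda _ fun i =>
    (measurable_polarSample l₁ l₂ (b none) δ).comp (measurable_pi_apply i)
  have hTm : Measurable T := measurable_sampleCov.comp hpolar
  have hlaw : ∀ j, spikedSampleCovLaw l₁ l₂ m (spike b δ j) = (Q.withDensity (f j)).map T := by
    intro j
    rw [spikedSampleCovLaw, ← spikedSampleLaw, spikedSampleLaw_spike_eq_map h₂ h,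
      Measure.map_map measurable_sampleCov hpolar]
    rfl
  set A : J → Set (Matrix (Fin n) (Fin n) ℝ) := fun j =>
    {V | frobNorm (outerSelf (v V) - outerSelf (spike b δ j)) < δ / 2} with hA
  have hAm : ∀ j, MeasurableSet (A j) := fun j =>
    measurableSet_lt (measurable_frobNorm_outerSelf_sub hv _) measurable_const
  -- An estimate cannot lie within `δ/2` of two `δ`-separated projectors.
  have hdisj : Pairwise (Function.onFun Disjoint fun j => T ⁻¹' A j) := by
    intro i j hij
    refine Disjoint.preimage T (Set.disjoint_left.2 fun V hVi hVj => ?_)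
    have h1 := le_frobNorm_outerSelf_spike_sub hb hδ0.le hδ hij
    have h2 := frobNorm_sub_le (outerSelf (spike b δ i)) (outerSelf (v V)) (outerSelf (spike b δ j))
    have h3 : frobNorm (outerSelf (v V) - outerSelf (spike b δ i)) < δ / 2 := hVi
    have h4 : frobNorm (outerSelf (v V) - outerSelf (spike b δ j)) < δ / 2 := hVj
    linarith
  set M : ℝ := (Fintype.card J : ℝ) with hM
  have hM0 : 0 < M := by rw [hM]; exact_mod_cast Fintype.card_pos
  set B : ℝ := Real.exp (m * (2 * ((l₁ - l₂) / l₂ * δ ^ 2))) with hB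
  -- With `t = M/4` the total success probability is at most `M/4 + 4B`, and `16 B ≤ M` makes this
  -- at most `M/2`.
  have hsum := sum_withDensity_le Q (f := f) (fun j => measurable_jointShearDensity m _)
    (B := ENNReal.ofReal B) (fun j => by
      have := lintegral_jointShearDensity_sq_le (m := m) (spikeShear l₁ l₂ b δ j)
        (by rwa [sum_spikeShear_sq h₂ h hb])
      rwa [sum_spikeShear_sq h₂ h hb] at this)
    (fun j => hTm (hAm j)) hdisj (t := ENNReal.ofReal (M / 4))
    (ENNReal.ofReal_pos.2 (by positivity)).ne' ENNReal.ofReal_ne_top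
  have hsum2 : ∑ j, Q.withDensity (f j) (T ⁻¹' A j) ≤ ∑ _j : J, ENNReal.ofReal (1 / 2) := by
    refine hsum.trans ?_
    rw [Finset.sum_const, Finset.card_univ, nsmul_eq_mul, ← ENNReal.ofReal_natCast, ← hM,
      ← ENNReal.ofReal_div_of_pos (by positivity), ← ENNReal.ofReal_mul hM0.le,
      ← ENNReal.ofReal_mul hM0.le, ← ENNReal.ofReal_add (by positivity) (by positivity)]
    apply ENNReal.ofReal_le_ofReal
    have : M * (B / (M / 4)) = 4 * B := by field_simp
    rw [this]
    linarith
  obtain ⟨j, -, hj⟩ := ENNReal.exists_le_of_sum_le Finset.univ_nonempty hsum2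
  refine ⟨j, ?_⟩
  have hprob : IsProbabilityMeasure (spikedSampleCovLaw l₁ l₂ m (spike b δ j)) :=
    Measure.isProbabilityMeasure_map measurable_sampleCov.aemeasurable
  have hj' : spikedSampleCovLaw l₁ l₂ m (spike b δ j) (A j) ≤ ENNReal.ofReal (1 / 2) := by
    rw [hlaw, Measure.map_apply hTm (hAm j)]; exact hj
  have hcompl : ENNReal.ofReal (1 / 2)
      ≤ spikedSampleCovLaw l₁ l₂ m (spike b δ j) (A j)ᶜ := by
    rw [prob_compl_eq_one_sub (hAm j)]
    refine le_trans ?_ (tsub_le_tsub_left hj' 1)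
    rw [← ENNReal.ofReal_one, ← ENNReal.ofReal_sub _ (by norm_num)]
    norm_num
  -- Markov: a loss of at least `δ/2` occurs with probability at least 1/2, giving risk `δ/4`.
  have hmk := mul_meas_ge_le_lintegral₀ (μ := spikedSampleCovLaw l₁ l₂ m (spike b δ j))
    (f := fun V => ENNReal.ofReal (frobNorm (outerSelf (v V) - outerSelf (spike b δ j))))
    (measurable_frobNorm_outerSelf_sub hv _).ennreal_ofReal.aemeasurable (ENNReal.ofReal (δ / 2))
  refine le_trans ?_ hmk
  rw [show δ / 4 = δ / 2 * (1 / 2) by ring, ENNReal.ofReal_mul (by positivity)]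
  gcongr
  refine hcompl.trans (measure_mono fun V hV => ?_)
  exact ENNReal.ofReal_le_ofReal (not_lt.1 hV)

end LowerBound

/-! ### Choice of parameters and the theorem -/

/-- Compares the second-moment bound with the packing number. As `65536 = 2^16`, the surplus `(3k/4)
log X` in the exponent absorbs both the factor 16 and the halving of `X`. -/
lemma sixteen_mul_exp_le_div_two_pow {X : ℝ} (hX : 65536 ≤ X) {k : ℕ} (hk : 0 < k) :
    16 * Real.exp (k / 4 * Real.log X) ≤ (X / 2) ^ k := by
  have hX0 : 0 < X := by linarith
  have hk1 : (1 : ℝ) ≤ k := by exact_mod_cast hk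
  have hlog : 16 * Real.log 2 ≤ Real.log X := by
    have h1 := Real.log_le_log (by norm_num) hX
    rwa [show (65536 : ℝ) = 2 ^ 16 by norm_num, Real.log_pow] at h1
  have hlog2 : 0 < Real.log 2 := Real.log_pos one_lt_two
  have h16 : (16 : ℝ) = Real.exp (4 * Real.log 2) := by
    have := Real.exp_nat_mul (Real.log 2) 4
    push_cast at this
    rw [this, Real.exp_log two_pos]
    norm_num
  have hpow : (X / 2) ^ k = Real.exp (k * (Real.log X - Real.log 2)) := by
    rw [Real.exp_nat_mul, Real.exp_sub, Real.exp_log hX0, Real.exp_log two_pos]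
  rw [hpow, h16, ← Real.exp_add]
  apply Real.exp_le_exp.2
  nlinarith

theorem theorem3 :
    ∃ K : ℝ, 0 < K ∧ ∀ l₁ l₂ : ℝ, 0 < l₂ → l₂ < l₁ →
      ∃ (c₀ : ℝ) (C c : ℝ → ℝ), 0 < c₀ ∧ (∀ a : ℝ, 0 < a → 0 < C a ∧ 0 < c a) ∧
      ∀ (r L : ℝ), 0 < r → 0 < L → K ≤ L * r → ∀ (k m : ℕ), 0 < k → 0 < m →
      ∃ (n : ℕ) (G : Metric.closedBall (0 : EuclideanSpace ℝ (Fin k)) r →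
          EuclideanSpace ℝ (Fin n)),
        LipschitzWith L.toNNReal G ∧
        (∀ z, ‖G z‖ = 1) ∧
        -- minimax lower bound over all measurable estimators of the observed matrix
        (∀ v : Matrix (Fin n) (Fin n) ℝ → EuclideanSpace ℝ (Fin n), Measurable v →
          ENNReal.ofReal (c₀ * min 1 (√((k : ℝ) * Real.log (L * r) / (m : ℝ)))) ≤
            ⨆ x ∈ Set.range G,
              ∫⁻ V, ENNReal.ofReal (frobNorm (outerSelf (v V) - outerSelf x))
                ∂(spikedSampleCovLaw l₁ l₂ m x)) ∧
        ∀ x ∈ Set.range G,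
          -- the population matrix is the mean of the observed one
          (∀ i j, Integrable (fun V : Matrix (Fin n) (Fin n) ℝ => V i j)
              (spikedSampleCovLaw l₁ l₂ m x) ∧
            ∫ V, V i j ∂(spikedSampleCovLaw l₁ l₂ m x) = spikedCov l₁ l₂ x i j) ∧
          -- its eigenvalues are `l₁, l₂, …, l₂`, with leading eigenvector `x`
          HasLeadingEigenpair (spikedCov l₁ l₂ x)
            (fun i => if (i : ℕ) = 0 then l₁ else l₂) x ∧
          -- the perturbation is small with high probability
          ∀ a : ℝ, 0 < a → ∀ S₁ S₂ : Finset (EuclideanSpace ℝ (Fin n)),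
            a * Real.log ((S₁.card : ℝ) * (S₂.card : ℝ)) ≤ (m : ℝ) →
            1 - Real.exp (-(c a * Real.log ((S₁.card : ℝ) * (S₂.card : ℝ))))
                - Real.exp (-(c a * (n : ℝ))) ≤
              (spikedSampleCovLaw l₁ l₂ m x).real
                {V | SmallPerturbation (C a) m S₁ S₂ (V - spikedCov l₁ l₂ x)} := by
  refine ⟨65536, by norm_num, fun l₁ l₂ h₂ h => ?_⟩
  have hl : 0 < l₁ := h₂.trans h
  set κ : ℝ := (l₁ - l₂) / l₂ with hκ
  have hκ0 : 0 < κ := div_pos (sub_pos.2 h) h₂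
  -- The 1/2 keeps `δ` in the Lipschitz range; the other term ensures `κ δ² ≤ θ²/8`, so that `2mκδ²
  -- ≤ (k/4) log(Lr)`.
  set c₁ : ℝ := min (1 / 2) (√(1 / (8 * κ))) with hc₁
  have hc₁0 : 0 < c₁ := lt_min (by norm_num) (Real.sqrt_pos.2 (by positivity))
  have hc₁κ : κ * c₁ ^ 2 ≤ 1 / 8 := by
    have h1 : c₁ ^ 2 ≤ 1 / (8 * κ) := by
      rw [← Real.sq_sqrt (show 0 ≤ 1 / (8 * κ) by positivity)]
      gcongr
      exact min_le_right _ _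
    calc κ * c₁ ^ 2 ≤ κ * (1 / (8 * κ)) := by gcongr
      _ = 1 / 8 := by field_simp
  refine ⟨c₁ / 4, perturbationConst l₁, fun a => min a 1, by positivity, fun a ha =>
    ⟨lt_max_of_lt_right (by positivity), lt_min ha one_pos⟩, ?_⟩
  intro r L hr hL hK k m hk hm
  obtain ⟨Z, hZball, hZsep, hZcard⟩ := exists_separated_finset_closedBall k hr
    (show 0 < 2 * L⁻¹ by positivity)
  rw [show r / (2 * L⁻¹) = L * r / 2 by field_simp] at hZcard
  have hX := sixteen_mul_exp_le_div_two_pow hK hk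
  have hlog : 0 < Real.log (L * r) := Real.log_pos (by linarith)
  set θ : ℝ := min 1 (√((k : ℝ) * Real.log (L * r) / (m : ℝ))) with hθ
  have hk' : (0 : ℝ) < k := by exact_mod_cast hk
  have hm' : (0 : ℝ) < m := by exact_mod_cast hm
  have hθ0 : 0 < θ := lt_min one_pos (Real.sqrt_pos.2 (by positivity))
  have hθ1 : θ ≤ 1 := min_le_left _ _
  have hθm : m * θ ^ 2 ≤ k * Real.log (L * r) := by
    have h1 : θ ^ 2 ≤ (k : ℝ) * Real.log (L * r) / (m : ℝ) := by
      rw [← Real.sq_sqrt (show 0 ≤ (k : ℝ) * Real.log (L * r) / (m : ℝ) by positivity)]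
      gcongr
      exact min_le_right _ _
    rw [mul_comm]
    exact (le_div_iff₀ hm').1 h1
  set δ : ℝ := c₁ * θ with hδ
  have hδ0 : 0 < δ := by positivity
  have hδ1 : δ ≤ 1 / 2 := by
    have : c₁ ≤ 1 / 2 := min_le_left _ _
    nlinarith
  have hs : κ * δ ^ 2 ≤ 1 / 8 * θ ^ 2 := by
    rw [hδ, mul_pow, ← mul_assoc]
    gcongr
  -- Room for the pole and one direction per packing point, and large enough for near-orthogonality
  -- of the samples.
  set n : ℕ := max (Z.card + 1) ⌈12 * (m : ℝ) ^ 2 * Real.exp m⌉₊ with hn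
  have hn1 : 12 * (m : ℝ) ^ 2 * Real.exp m ≤ n :=
    (Nat.le_ceil _).trans (Nat.cast_le.2 (le_max_right _ _))
  have hn0 : 0 < n := lt_of_lt_of_le (Nat.succ_pos _) (le_max_left _ _)
  obtain ⟨e⟩ : Nonempty (Option Z ↪ Fin n) := by
    apply Function.Embedding.nonempty_of_card_le
    rw [Fintype.card_option, Fintype.card_coe, Fintype.card_fin]
    exact le_max_left _ _
  set b : Option Z → EuclideanSpace ℝ (Fin n) := fun o => EuclideanSpace.basisFun (Fin n) ℝ (e o)
  have hb : Orthonormal ℝ b :=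
    (EuclideanSpace.basisFun (Fin n) ℝ).orthonormal.comp e e.injective
  have hL' : 0 < L⁻¹ := by positivity
  have hsep : ∀ i j : Z, i ≠ j → 2 * L⁻¹ < dist (i : EuclideanSpace ℝ (Fin k)) j :=
    fun i j hij => hZsep i i.2 j j.2 (Subtype.coe_injective.ne hij)
  have hnorm := norm_tentGenerator hb hδ0.le (by linarith) hL' hsep
  refine ⟨n, fun z => tentGenerator b δ L⁻¹ (fun j : Z => (j : EuclideanSpace ℝ (Fin k))) z, ?_,
    fun z => hnorm z, ?_, ?_⟩
  · refine LipschitzWith.of_dist_le_mul fun z z' => ?_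
    rw [dist_eq_norm, Real.coe_toNNReal _ hL.le]
    refine (norm_tentGenerator_sub_le hb hδ0.le hδ1 hL' hsep _ _).trans (le_of_eq ?_)
    rw [div_inv_eq_mul, mul_comm]
    rfl
  · intro v hv
    have hcard : 16 * Real.exp (m * (2 * (κ * δ ^ 2))) ≤ Fintype.card Z := by
      rw [Fintype.card_coe]
      refine le_trans ?_ (hX.trans hZcard)
      refine mul_le_mul_of_nonneg_left (Real.exp_le_exp.2 ?_) (by norm_num)
      have := mul_le_mul_of_nonneg_left hs hm'.le
      linarith
    have hZ : Nonempty Z := by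
      rw [← Fintype.card_pos_iff, ← Nat.cast_pos (α := ℝ)]
      exact lt_of_lt_of_le (by positivity) hcard
    obtain ⟨j, hj⟩ := exists_spike_lintegral_frobNorm_ge h₂ h.le hb hδ0 hδ1
      (by nlinarith) hcard hv
    rw [show c₁ / 4 * θ = δ / 4 by rw [hδ]; ring]
    refine hj.trans (le_iSup₂_of_le (spike b δ j) ?_ le_rfl)
    exact ⟨⟨j, hZball j j.2⟩, tentGenerator_center hb hL' hsep j⟩
  · rintro _ ⟨z, rfl⟩
    exact ⟨mean_spikedSampleCovLaw h₂.le h.le hm,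
      hasLeadingEigenpair_spikedCov h₂ h (hnorm z) hn0,
      fun a ha S₁ S₂ => spikedSampleCovLaw_smallPerturbation_ge h₂ h.le (hnorm z) hm hn1 ha S₁ S₂⟩
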